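/- **Codings.** Let $\langle x,y\rangle=\frac12(x^2+2xy+y^2+3x+y)$ be Cantor's pairing function on $\mathbb N=\{0,1,2,\dots\}$, put $\langle x_1\rangle=x_1$ and $\langle x_1,\dots,x_n\rangle=\langle\langle x_1,\dots,x_{n-1}\rangle,x_n\rangle$, and let $\pi^n_i\langle x_1,\dots,x_n\rangle=x_i$. An integer $i$ is coded by $\zeta(i)=-2i-1$ if $i<0$ and $\zeta(i)=2i$ if $i\ge 0$; a rational $q=a/b$ in lowest terms ($b>0$) is coded by $\rho(q)=\zeta\bigl((\operatorname{sgn}a)\prod_p p^{\zeta(v_p(a)-v_p(b))}\bigr)$ (product over all primes; $\rho(0)=0$). For rationals $a,b$ let $\iota\langle\rho(a),\rho(b)\rangle=\{x\in\mathbb R: a<x<b\}$. **Effective topologies.** An effective topology $(\mathcal B,\nu)$ on a set $X$ consists of a countable basis $\mathcal B$ of a $T_0$ topology on $X$ and a map $\nu$ on $\mathbb N$ such that every member of $\mathcal B$ is $\nu(n)$ for some $n$; put $\operatorname{dom}\nu=\{n:\nu(n)\in\mathcal B\}$. A local basis for $x\in X$ is a set $\mathcal L\subseteq\mathcal B$ all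 of whose members contain $x$ and such that every $B\in\mathcal B$ with $x\in B$ includes some $L\in\mathcal L$. A function $\phi:\mathbb N\to\operatorname{dom}\nu$ is an oracle for $x$ if $\{\nu(\phi(n)):n\in\mathbb N\}$ is a local basis for $x$; it is nested if $\nu(\phi(n+1))\subseteq\nu(\phi(n))$ for all $n$. A set $R\subseteq\operatorname{dom}\nu$ is a basic representation of $A\subseteq X$ if, for all $x\in X$: $x\in A$ if and only if some local basis $\mathcal L$ for $x$ satisfies $\mathcal L\subseteq\nu(R)$. The effective product of $(\mathcal B_1,\nu_1),\dots,(\mathcal B_n,\nu_n)$ has the basis of all $B_1\times\dots\times B_n$ with $B_i\in\mathcal B_i$, and the coding $\nu\langle a_1,\dots,a_n\rangle=\nu_1(a_1)\times\dots\times\nu_n(a_n)$. Let $\mathcal I$ be the set of all open intervals $(a,b)$ with rational $a<b$. For a rational $c>0$ let $\mathcal I_{10,c}$ be the set of all open intervals $\bigl(\frac{m-c}{10^d},\frac{m+1+c}{10^d}\bigr)$ with $m\in\mathbb Z$ and $d$ a positive integer. Both $(\mathcal I,\iota)$ and $(\mathcal I_{10,c},\iota)$ are effective topologies on $\mathbb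 R$. **Physical models.** A physical model $(S,A)$ is a set $S$ of states with a set $A$ of functions on states (observable quantities). It is isomorphic to $(T,B)$ if there are bijections $f:S\to T$ and $g:A\to B$ with $\alpha(s)=g(\alpha)(f(s))$ for all $s\in S$, $\alpha\in A$. It is a computable physical model if $S\subseteq\mathbb N$ is recursive and every member of $A$ is a total recursive function $\mathbb N\to\mathbb N$. For $n>k$, the model is induced by $\psi:\mathbb R^k\to\mathbb R^{n-k}$ if $S\subseteq\mathbb R^n$ is the graph of $\psi$ and $A$ is the set of the $n$ coordinate projections on $\mathbb R^n$. A basic representation of such a model in an effective product of effective topologies on $n$ copies of $\mathbb R$ is a pair $(R,H)$ in which $R$ is a basic representation of $S$ in that product and $H=\{\pi^n_1,\dots,\pi^n_n\}$. **Kreisel's criterion.** The model satisfies Kreisel's criterion on $\mathbb R^k$ if it is induced by some $\psi:\mathbb R^k\to\mathbb R^{n-k}$, $n>k$, and for each $j\in\{1,\dots,n-k\}$ there is a partial recursive functional $\kappa_j$ (computed by a program with $k$ function oracles) such that, whenever $\phi_1,\dots,\phi_k$ are nested oracles for real numbers $x_1,\dots,x_k$ in $(\mathcal I,\iota)$, the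 value $\kappa_j(\phi_1,\dots,\phi_k,l)$ is defined for all $l\in\mathbb N$ and $l\mapsto\kappa_j(\phi_1,\dots,\phi_k,l)$ is a nested oracle in $(\mathcal I,\iota)$ for the $j$-th coordinate of $\psi(x_1,\dots,x_k)$. **Theorem.** Let $n>k\ge 0$ be integers and let $c>0$ be rational. If a physical model $(S,A)$ with $S\subseteq\mathbb R^n$ satisfies Kreisel's criterion on $\mathbb R^k$, then it has a basic representation $(R,H)$, in the effective product of $n$ copies of $(\mathcal I_{10,c},\iota)$, that is isomorphic to a computable physical model. Moreover this holds uniformly: for fixed $k,n,c$ there is an algorithm that, given programs for any functionals $\kappa_1,\dots,\kappa_{n-k}$ which witness Kreisel's criterion for a model $(S,A)$, outputs a program whose domain is the set $R$ of states of such a basic representation $(R,H)$, a program that computes the characteristic function of the set $T$ of states of a computable physical model $(T,B)$, and, for $i=1,\dots,n$, a program that computes $\beta_i\in B$, where some isomorphism from $(R,H)$ to $(T,B)$ maps $\pi^n_i$ to $\beta_i$ for every $i$. -/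

import Mathlib

namespace CPM

/-! ### Codings by non-negative integers -/

/-- Cantor's pairing function `⟨x, y⟩ = (x² + 2xy + y² + 3x + y) / 2`. The division is exact. -/
def cantorPair (x y : ℕ) : ℕ := (x ^ 2 + 2 * x * y + y ^ 2 + 3 * x + y) / 2

theorem two_mul_cantorPair (x y : ℕ) :
    2 * cantorPair x y = (x + y) * (x + y + 1) + 2 * x := by
  have h : x ^ 2 + 2 * x * y + y ^ 2 + 3 * x + y = (x + y) * (x + y + 1) + 2 * x := by ring
  have h2 : 2 ∣ (x + y) * (x + y + 1) + 2 * x :=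
    (Nat.even_mul_succ_self (x + y)).two_dvd.add (Dvd.intro _ rfl)
  unfold cantorPair
  rw [h]
  exact Nat.mul_div_cancel' h2

theorem cantorPair_injective {a b x y : ℕ} (h : cantorPair a b = cantorPair x y) :
    a = x ∧ b = y := by
  have h1 := two_mul_cantorPair a b
  have h2 := two_mul_cantorPair x y
  rw [h] at h1
  have hs : a + b = x + y := by
    rcases lt_trichotomy (a + b) (x + y) with hlt | heq | hgt
    · nlinarith
    · exact heq
    · nlinarith
  rw [hs] at h1
  omega

/-- The code `⟨x₁, …, xₙ⟩ = ⟨⟨x₁, …, xₙ₋₁⟩, xₙ⟩` of a sequence of length `n ≥ 1`,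
where `⟨x₁⟩ = x₁`. -/
def seqCode : {n : ℕ} → (Fin n → ℕ) → ℕ
  | 0, _ => 0
  | 1, x => x 0
  | _ + 2, x => cantorPair (seqCode (Fin.init x)) (x (Fin.last _))

theorem seqCode_injective : ∀ n : ℕ, Function.Injective (seqCode (n := n))
  | 0 => fun x y _ => funext fun i => i.elim0
  | 1 => fun x y h => funext fun i => by
      rw [Subsingleton.elim i 0]; exact h
  | n + 2 => fun x y h => by
      obtain ⟨h1, h2⟩ := cantorPair_injective h
      have h3 := seqCode_injective (n + 1) h1
      rw [← Fin.snoc_init_self x, ← Fin.snoc_init_self y, h3, h2]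

/-- The projection function `πᵢⁿ`, with `πᵢⁿ⟨x₁, …, xₙ⟩ = xᵢ`. For `n ≥ 1` every non-negative
integer is the code of exactly one sequence of length `n`. -/
noncomputable def seqProj {n : ℕ} (i : Fin n) (s : ℕ) : ℕ :=
  Function.invFun (seqCode (n := n)) s i

theorem seqProj_seqCode {n : ℕ} (i : Fin n) (x : Fin n → ℕ) : seqProj i (seqCode x) = x i := by
  unfold seqProj
  rw [Function.leftInverse_invFun (seqCode_injective n) x]

/-- The code of an integer: `ζ(i) = -2i - 1` for `i < 0` and `ζ(i) = 2i` for `i ≥ 0`. -/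
def zeta (i : ℤ) : ℕ := if i < 0 then (-2 * i - 1).toNat else (2 * i).toNat

/-- The code of a rational number `q = a / b` in lowest terms:
`ρ(q) = ζ((sgn a) ∏ₚ p ^ ζ(vₚ(a) - vₚ(b)))`, the product being over all primes `p`
(only those dividing `a` or `b` contribute a factor other than `1`). -/
def rho (q : ℚ) : ℕ :=
  zeta (q.num.sign *
    ∏ p ∈ (q.num.natAbs * q.den).primeFactors, (p : ℤ) ^ zeta (padicValRat p q))

/-- The code `⟨ρ(a), ρ(b)⟩` of a pair of rational numbers. -/
def ratPair (a b : ℚ) : ℕ := cantorPair (rho a) (rho b)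

/-! ### Effective topologies and oracles -/

/-- A pair `(B, ν)` consisting of a family `B` of subsets of `X` and a map `ν` that
assigns a subset of `X` to each non-negative integer. -/
structure CodedBasis (X : Type) where
  basis : Set (Set X)
  coding : ℕ → Set X

namespace CodedBasis

variable {X : Type}

/-- The domain of the coding: the integers that encode members of the family. -/
def dom (τ : CodedBasis X) : Set ℕ := {n | τ.coding n ∈ τ.basis}

/-- `(B, ν)` is an effective topology on `X`: `B` is a basis of some T₀ topology on `X`
and every member of `B` has a code (so that `B` is countable). -/
def IsEffectiveTopology (τ : CodedBasis X) : Prop :=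
  (∃ t : TopologicalSpace X,
    @TopologicalSpace.IsTopologicalBasis X t τ.basis ∧ @T0Space X t) ∧
  τ.basis ⊆ Set.range τ.coding

/-- `L` is a local basis for the point `x`. -/
def IsLocalBasis (τ : CodedBasis X) (x : X) (L : Set (Set X)) : Prop :=
  L ⊆ τ.basis ∧ (∀ U ∈ L, x ∈ U) ∧ ∀ V ∈ τ.basis, x ∈ V → ∃ U ∈ L, U ⊆ V

/-- `φ` is an oracle for the point `x`. -/
def IsOracle (τ : CodedBasis X) (φ : ℕ → ℕ) (x : X) : Prop :=
  (∀ n, φ n ∈ τ.dom) ∧ τ.IsLocalBasis x (τ.coding '' Set.range φ)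

/-- `φ` is a nested oracle for the point `x`. -/
def IsNestedOracle (τ : CodedBasis X) (φ : ℕ → ℕ) (x : X) : Prop :=
  τ.IsOracle φ x ∧ ∀ n, τ.coding (φ (n + 1)) ⊆ τ.coding (φ n)

/-- The set `R` of non-negative integers is a basic representation of `A ⊆ X`. -/
def IsBasicRepresentation (τ : CodedBasis X) (R : Set ℕ) (A : Set X) : Prop :=
  R ⊆ τ.dom ∧ ∀ x, x ∈ A ↔ ∃ L, τ.IsLocalBasis x L ∧ L ⊆ τ.coding '' R

/-- The effective product of `n` coded bases, with basis the products `B₁ × ⋯ × Bₙ` of basis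
elements and coding `ν⟨a₁, …, aₙ⟩ = ν₁(a₁) × ⋯ × νₙ(aₙ)`. -/
def product {n : ℕ} (τ : Fin n → CodedBasis X) : CodedBasis (Fin n → X) where
  basis := {U | ∃ V : Fin n → Set X, (∀ i, V i ∈ (τ i).basis) ∧ U = Set.univ.pi V}
  coding s := Set.univ.pi fun i => (τ i).coding (seqProj i s)

end CodedBasis

/-- The coding `ι` of open intervals with rational end points: the code `⟨ρ(a), ρ(b)⟩`
stands for `{x | a < x < b}`. -/
def iota (s : ℕ) : Set ℝ := {x | ∃ a b : ℚ, s = ratPair a b ∧ (a : ℝ) < x ∧ x < (b : ℝ)}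

/-- The rational intervals `(I, ι)`. -/
def rationalIntervals : CodedBasis ℝ where
  basis := {U | ∃ a b : ℚ, a < b ∧ U = Set.Ioo (a : ℝ) (b : ℝ)}
  coding := iota

/-- The decimal intervals with accuracy factor `c`: the intervals with end points
`(m - c) / 10ⁿ` and `(m + 1 + c) / 10ⁿ` for an integer `m` and a positive integer `n`,
with the coding `ι`. -/
def decimalIntervals (c : ℚ) : CodedBasis ℝ where
  basis := {U | ∃ (m : ℤ) (n : ℕ), 0 < n ∧
    U = Set.Ioo ((m : ℝ) / 10 ^ n - (c : ℝ) / 10 ^ n)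
      (((m : ℝ) + 1) / 10 ^ n + (c : ℝ) / 10 ^ n)}
  coding := iota

/-! ### Partial recursive functionals

Programs for unlimited register machines with `k` function oracles. -/

/-- The instructions of an unlimited register machine with `k` oracles. -/
inductive Instr (k : ℕ) : Type
  /-- Set register `r` to zero. -/
  | zero (r : ℕ)
  /-- Add one to register `r`. -/
  | succ (r : ℕ)
  /-- Copy the content of register `r` to register `s`. -/
  | copy (r s : ℕ)
  /-- Go to instruction number `q` if the registers `r` and `s` have the same content. -/
  | jump (r s q : ℕ)
  /-- Replace the content `l` of register `r` by the value of oracle number `i` at `l`. -/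
  | query (i : Fin k) (r : ℕ)

/-- Instructions as tuples of numbers; this provides their Gödel numbering. -/
def Instr.equivSum (k : ℕ) : Instr k ≃ ℕ ⊕ ℕ ⊕ (ℕ × ℕ) ⊕ (ℕ × ℕ × ℕ) ⊕ (Fin k × ℕ) where
  toFun
    | .zero r => .inl r
    | .succ r => .inr (.inl r)
    | .copy r s => .inr (.inr (.inl (r, s)))
    | .jump r s q => .inr (.inr (.inr (.inl (r, s, q))))
    | .query i r => .inr (.inr (.inr (.inr (i, r))))
  invFun
    | .inl r => .zero r
    | .inr (.inl r) => .succ r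
    | .inr (.inr (.inl (r, s))) => .copy r s
    | .inr (.inr (.inr (.inl (r, s, q)))) => .jump r s q
    | .inr (.inr (.inr (.inr (i, r)))) => .query i r
  left_inv x := by cases x <;> rfl
  right_inv x := by rcases x with _ | _ | ⟨_, _⟩ | ⟨_, _, _⟩ | ⟨_, _⟩ <;> rfl

instance (k : ℕ) : Primcodable (Instr k) := Primcodable.ofEquiv _ (Instr.equivSum k)

/-- An oracle program is a finite list of instructions, numbered from `0`. -/
abbrev OracleProgram (k : ℕ) : Type := List (Instr k)

/-- A configuration: the number of the next instruction and the contents of the registers. -/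
structure Config : Type where
  pc : ℕ
  reg : ℕ → ℕ

/-- The effect of one instruction, given the oracles `φ`. -/
def Instr.run {k : ℕ} (φ : Fin k → ℕ → ℕ) (C : Config) : Instr k → Config
  | .zero r => ⟨C.pc + 1, Function.update C.reg r 0⟩
  | .succ r => ⟨C.pc + 1, Function.update C.reg r (C.reg r + 1)⟩
  | .copy r s => ⟨C.pc + 1, Function.update C.reg s (C.reg r)⟩
  | .jump r s q => ⟨if C.reg r = C.reg s then q else C.pc + 1, C.reg⟩
  | .query i r => ⟨C.pc + 1, Function.update C.reg r (φ i (C.reg r))⟩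

/-- One step of a program; the program halts when there is no next instruction. -/
def OracleProgram.step {k : ℕ} (P : OracleProgram k) (φ : Fin k → ℕ → ℕ) (C : Config) :
    Option Config :=
  P[C.pc]?.map (Instr.run φ C)

/-- The value `κ(φ₁, …, φₖ, m)` of the partial recursive functional `κ` that is computed by `P`:
start at instruction `0` with `m` in register `0` and zero in all other registers, run until the
program halts, and read register `0`. -/
def OracleProgram.eval {k : ℕ} (P : OracleProgram k) (φ : Fin k → ℕ → ℕ) (m : ℕ) : Part ℕ :=
  (StateTransition.eval (P.step φ) ⟨0, Function.update (fun _ => 0) 0 m⟩).map fun C => C.reg 0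

/-! ### Physical models -/

/-- A physical model `(S, A)`: a set `S` of states and a set `A` of observable quantities. -/
structure PhysicalModel (α β : Type) where
  states : Set α
  observables : Set (α → β)

namespace PhysicalModel

/-- An isomorphism of physical models. -/
structure Iso {α β γ : Type} (M : PhysicalModel α γ) (N : PhysicalModel β γ) where
  onStates : M.states ≃ N.states
  onObservables : M.observables ≃ N.observables
  compat : ∀ (a : M.observables) (s : M.states), a.1 s.1 = (onObservables a).1 (onStates s).1

/-- Two physical models are isomorphic. -/
def Isomorphic {α β γ : Type} (M : PhysicalModel α γ) (N : PhysicalModel β γ) : Prop :=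
  Nonempty (Iso M N)

/-- A computable physical model: a recursive set of states, and total recursive functions as
observable quantities. -/
def IsComputable (M : PhysicalModel ℕ ℕ) : Prop :=
  ComputablePred (fun s => s ∈ M.states) ∧ ∀ a ∈ M.observables, Computable a

/-- A physical model in normal form: the states are points of `ℝⁿ` and the observable
quantities are the `n` coordinate projections. -/
def IsNormalForm {n : ℕ} (M : PhysicalModel (Fin n → ℝ) ℝ) : Prop :=
  M.observables = Set.range fun (i : Fin n) (x : Fin n → ℝ) => x i

/-- The model is induced by `ψ : ℝᵏ → ℝᵐ`: it is in normal form and its set of states is the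
graph of `ψ`, as a subset of `ℝᵏ⁺ᵐ`. -/
def IsInducedBy {k m : ℕ} (M : PhysicalModel (Fin (k + m) → ℝ) ℝ)
    (ψ : (Fin k → ℝ) → (Fin m → ℝ)) : Prop :=
  M.IsNormalForm ∧
    M.states = {z | ψ (fun i => z (Fin.castAdd m i)) = fun j => z (Fin.natAdd k j)}

/-- `N` is a basic representation of the model `M` in normal form, in the effective product of
the effective topologies `τ₁, …, τₙ` on the real line. -/
def IsBasicRepresentation {n : ℕ} (τ : Fin n → CodedBasis ℝ) (N : PhysicalModel ℕ ℕ)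
    (M : PhysicalModel (Fin n → ℝ) ℝ) : Prop :=
  M.IsNormalForm ∧ (∀ i, (τ i).IsEffectiveTopology) ∧
    (CodedBasis.product τ).IsBasicRepresentation N.states M.states ∧
    N.observables = Set.range fun i : Fin n => seqProj i

/-- The programs `P₁, …, Pₘ` compute functionals that witness Kreisel's criterion for the
model `M`. -/
def KreiselPrograms {k m : ℕ} (M : PhysicalModel (Fin (k + m) → ℝ) ℝ)
    (P : Fin m → OracleProgram k) : Prop :=
  ∃ ψ : (Fin k → ℝ) → (Fin m → ℝ), M.IsInducedBy ψ ∧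
    ∀ (x : Fin k → ℝ) (φ : Fin k → ℕ → ℕ),
      (∀ i, rationalIntervals.IsNestedOracle (φ i) (x i)) →
      ∀ j, ∃ κ : ℕ → ℕ, (∀ l, (P j).eval φ l = Part.some (κ l)) ∧
        rationalIntervals.IsNestedOracle κ (ψ x j)

/-- The model `M` satisfies Kreisel's criterion on `ℝᵏ`. -/
def SatisfiesKreisel {k m : ℕ} (M : PhysicalModel (Fin (k + m) → ℝ) ℝ) : Prop :=
  ∃ P : Fin m → OracleProgram k, M.KreiselPrograms P

end PhysicalModel

end CPM

namespace CPM

/-! A halting computation reads only finitely many oracle values, and a finite nested sequence of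
rational intervals around a point extends to a nested oracle for any point of its last interval.
Hence an output interval computed from nested oracles for `x` is also an output for all `x'` near
`x`, so `ψ` is continuous (`continuous_of_oracle_functionals`) and its graph `S` is closed.

For a closed set, the codes of all basic boxes that meet it form a basic representation
(`isBasicRepresentation_meetingBoxes`): a point of the set has all its boxes available, and a point
with a local basis of such boxes is in the closure. This gives `R = meetingBoxes c S`.

`R` is recursively enumerable. That a box meets `S` is certified by finite data: finite nested
interval sequences ending inside the first `k` sides, and for each functional a halting computation
on these data whose output interval lies inside the matching one of the last `m` sides. Certificates
are sound (`mem_meetingBoxes_of_isBoxWitness`), exist for each box in `R` (`exists_isBoxWitness`),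
and are checked primitive recursively, uniformly in the programs (`primrecRel_isBoxWitness`).
Checking needs arithmetic on codes of rationals; a closed form for `rho`
(`rhoAbs_mul_prod_primeFactors`) avoids factoring.

`R` need not be recursive, so each `s ∈ R` is replaced by the pair of `s` and the time at which a
program with domain `R` first halts on `s`. The set of these pairs is recursive, projecting to `s`
is a bijection onto `R`, and observables are composed with that projection
(`exists_iso_haltingModel`). The parameter theorem makes the programs computable from the given
ones. -/

/-! ### Injectivity of the codings and a closed form for `rho`. -/

theorem zeta_natCast (n : ℕ) : zeta n = 2 * n := by
  unfold zeta
  split <;> omega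

theorem zeta_neg_natCast {n : ℕ} (hn : 0 < n) : zeta (-(n : ℤ)) = 2 * n - 1 := by
  unfold zeta
  split <;> omega

theorem zeta_injective : Function.Injective zeta := by
  intro a b h
  unfold zeta at h
  split at h <;> split at h <;> omega

/-- The absolute value of the integer whose code is `rho q`. -/
def rhoAbs (q : ℚ) : ℕ :=
  ∏ p ∈ (q.num.natAbs * q.den).primeFactors, p ^ zeta (padicValRat p q)

theorem rho_eq_zeta (q : ℚ) : rho q = zeta (q.num.sign * (rhoAbs q : ℤ)) := by
  simp [rho, rhoAbs]

theorem rhoAbs_pos (q : ℚ) : 0 < rhoAbs q :=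
  Finset.prod_pos fun _ hp => pow_pos (Nat.prime_of_mem_primeFactors hp).pos _

theorem padicValRat_eq_sub {p : ℕ} (q : ℚ) :
    padicValRat p q = (padicValNat p q.num.natAbs : ℤ) - padicValNat p q.den := rfl

/-- Primes outside the finite product fit the same formula, because both valuations vanish there and
`zeta 0 = 0`. -/
theorem factorization_rhoAbs {q : ℚ} (hq : q ≠ 0) {p : ℕ} (hp : p.Prime) :
    (rhoAbs q).factorization p = zeta (padicValRat p q) := by
  have hn : q.num.natAbs ≠ 0 := by simpa using hq
  unfold rhoAbs
  rw [Nat.factorization_prod fun i hi => pow_ne_zero _ (Nat.prime_of_mem_primeFactors hi).ne_zero,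
    Finset.sum_apply']
  have key : ∀ i ∈ (q.num.natAbs * q.den).primeFactors,
      (i ^ zeta (padicValRat i q)).factorization p =
        if i = p then zeta (padicValRat p q) else 0 := by
    intro i hi
    rw [(Nat.prime_of_mem_primeFactors hi).factorization_pow, Finsupp.single_apply]
    split
    · next h => rw [h]
    · rfl
  rw [Finset.sum_congr rfl key, Finset.sum_ite_eq']
  split
  · rfl
  · next h =>
    have h1 : ¬ p ∣ q.num.natAbs * q.den := fun hd =>
      h (Nat.mem_primeFactors.2 ⟨hp, hd, mul_ne_zero hn q.den_ne_zero⟩)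
    have h2 : ¬ p ∣ q.num.natAbs := fun hd => h1 (hd.mul_right _)
    have h3 : ¬ p ∣ q.den := fun hd => h1 (hd.mul_left _)
    rw [padicValRat_eq_sub, padicValNat.eq_zero_of_not_dvd h2, padicValNat.eq_zero_of_not_dvd h3]
    rfl

/-- The code determines the sign and, by unique factorization, every `p`-adic valuation. To stay in
`ℕ`, equality of valuations is read as equality of the factorizations of the two cross products. -/
theorem rho_injective : Function.Injective rho := by
  intro q r h
  rw [rho_eq_zeta, rho_eq_zeta] at h
  replace h := zeta_injective h
  have hqp := rhoAbs_pos q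
  have hrp := rhoAbs_pos r
  have hsign : q.num.sign = r.num.sign := by
    have := congrArg Int.sign h
    rwa [Int.sign_mul, Int.sign_mul, Int.sign_sign, Int.sign_sign,
      Int.sign_eq_one_of_pos (a := (rhoAbs q : ℤ)) (by exact_mod_cast hqp),
      Int.sign_eq_one_of_pos (a := (rhoAbs r : ℤ)) (by exact_mod_cast hrp),
      mul_one, mul_one] at this
  by_cases hq : q = 0
  · subst hq
    rw [Rat.num_zero, Int.sign_zero] at hsign
    exact (Rat.num_eq_zero.1 (Int.sign_eq_zero_iff_zero.1 hsign.symm)).symm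
  have hs0 : q.num.sign ≠ 0 := by simpa [Int.sign_eq_zero_iff_zero] using hq
  have hr : r ≠ 0 := by
    rintro rfl
    rw [Rat.num_zero, Int.sign_zero] at hsign
    exact hs0 hsign
  have habs : rhoAbs q = rhoAbs r := by
    rw [← hsign] at h
    exact_mod_cast mul_left_cancel₀ hs0 h
  have hqn : q.num.natAbs ≠ 0 := by simpa using hq
  have hrn : r.num.natAbs ≠ 0 := by simpa using hr
  have hmul : q.num.natAbs * r.den = r.num.natAbs * q.den := by
    refine Nat.eq_of_factorization_eq (mul_ne_zero hqn r.den_ne_zero)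
      (mul_ne_zero hrn q.den_ne_zero) fun p => ?_
    by_cases hp : p.Prime
    · have h1 := zeta_injective
        ((factorization_rhoAbs hq hp).symm.trans (habs ▸ factorization_rhoAbs hr hp))
      rw [padicValRat_eq_sub, padicValRat_eq_sub] at h1
      rw [Nat.factorization_mul hqn r.den_ne_zero, Nat.factorization_mul hrn q.den_ne_zero]
      simp only [Finsupp.add_apply, Nat.factorization_def _ hp]
      omega
    · simp [Nat.factorization_eq_zero_of_not_prime _ hp]
  rw [Rat.eq_iff_mul_eq_mul, ← Int.sign_mul_natAbs q.num, ← Int.sign_mul_natAbs r.num, hsign,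
    mul_assoc, mul_assoc]
  congr 1
  exact_mod_cast hmul

theorem ratPair_inj {a b a' b' : ℚ} (h : ratPair a b = ratPair a' b') : a = a' ∧ b = b' :=
  let ⟨h1, h2⟩ := cantorPair_injective h
  ⟨rho_injective h1, rho_injective h2⟩

theorem iota_ratPair (a b : ℚ) : iota (ratPair a b) = Set.Ioo (a : ℝ) b := by
  ext x
  constructor
  · rintro ⟨a', b', h, h1, h2⟩
    obtain ⟨rfl, rfl⟩ := ratPair_inj h
    exact ⟨h1, h2⟩
  · rintro ⟨h1, h2⟩
    exact ⟨a, b, rfl, h1, h2⟩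

/-- A prime with exponent `v` in the numerator gets exponent `2v`, and one with exponent `v` in the
denominator gets `2v - 1`. So only the radical of the denominator is missing from a square, and
given that radical the code needs no factoring. -/
theorem rhoAbs_mul_prod_primeFactors {q : ℚ} (hq : q ≠ 0) :
    rhoAbs q * ∏ p ∈ q.den.primeFactors, p = q.num.natAbs ^ 2 * q.den ^ 2 := by
  have hn : q.num.natAbs ≠ 0 := by simpa using hq
  have hcop : q.num.natAbs.Coprime q.den := q.reduced
  have hnum : ∏ p ∈ q.num.natAbs.primeFactors, p ^ zeta (padicValRat p q) =
      q.num.natAbs ^ 2 := by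
    conv_rhs => rw [← Nat.prod_factorization_pow_eq_self hn, Finsupp.prod, ← Finset.prod_pow]
    refine Finset.prod_congr rfl fun p hp => ?_
    have hp' := Nat.prime_of_mem_primeFactors hp
    have hd : ¬ p ∣ q.den := fun hd =>
      hp'.one_lt.ne' (Nat.eq_one_of_dvd_coprimes hcop (Nat.dvd_of_mem_primeFactors hp) hd)
    rw [padicValRat_eq_sub, padicValNat.eq_zero_of_not_dvd hd, Nat.cast_zero, sub_zero,
      zeta_natCast, ← pow_mul, Nat.factorization_def _ hp', mul_comm]
  have hden : (∏ p ∈ q.den.primeFactors, p ^ zeta (padicValRat p q)) *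
      ∏ p ∈ q.den.primeFactors, p = q.den ^ 2 := by
    conv_rhs => rw [← Nat.prod_factorization_pow_eq_self q.den_ne_zero, Finsupp.prod,
      ← Finset.prod_pow]
    rw [← Finset.prod_mul_distrib]
    refine Finset.prod_congr rfl fun p hp => ?_
    have hp' := Nat.prime_of_mem_primeFactors hp
    have hd : ¬ p ∣ q.num.natAbs := fun hd =>
      hp'.one_lt.ne' (Nat.eq_one_of_dvd_coprimes hcop hd (Nat.dvd_of_mem_primeFactors hp))
    have hv : 0 < padicValNat p q.den := by
      rw [← Nat.factorization_def _ hp']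
      exact hp'.factorization_pos_of_dvd q.den_ne_zero (Nat.dvd_of_mem_primeFactors hp)
    rw [padicValRat_eq_sub, padicValNat.eq_zero_of_not_dvd hd, Nat.cast_zero, zero_sub,
      zeta_neg_natCast hv, ← pow_mul, Nat.factorization_def _ hp', ← pow_succ]
    congr 1
    omega
  rw [rhoAbs, hcop.primeFactors_mul, Finset.prod_union hcop.disjoint_primeFactors, hnum,
    mul_assoc, hden]

/-! ### Rational numbers as tuples of natural numbers. -/

/-- A triple `(x, y, b)` standing for the fraction `(x - y) / b`. -/
abbrev Frac : Type := ℕ × ℕ × ℕ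

/-- The value of a fraction. -/
def fracVal (t : Frac) : ℚ := ((t.1 : ℚ) - t.2.1) / t.2.2

/-- Comparison of fractions by cross-multiplication. -/
def FracLE (t u : Frac) : Prop :=
  t.1 * u.2.2 + u.2.1 * t.2.2 ≤ u.1 * t.2.2 + t.2.1 * u.2.2

theorem fracLE_iff {t u : Frac} (ht : 0 < t.2.2) (hu : 0 < u.2.2) :
    FracLE t u ↔ fracVal t ≤ fracVal u := by
  unfold FracLE fracVal
  rw [div_le_div_iff₀ (by exact_mod_cast ht) (by exact_mod_cast hu), ← Nat.cast_le (α := ℚ)]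
  push_cast
  constructor <;> intro h <;> linarith

/-- A reduced fraction `(x - y) / b` together with the radical of `b`. -/
abbrev RatRep : Type := Frac × ℕ

/-- The conditions for `((x, y, b), r)` to be a reduced fraction and the radical of its
denominator. -/
def RatRepValid (w : RatRep) : Prop :=
  (w.1.1 = 0 ∨ w.1.2.1 = 0) ∧ 0 < w.1.2.2 ∧
    (∀ d < w.1.2.2 + 1, d ∣ w.1.2.2 ∧ d ∣ w.1.1 + w.1.2.1 → d = 1) ∧
    w.2 ∣ w.1.2.2 ∧ w.1.2.2 ∣ w.2 ^ w.1.2.2 ∧ ∀ d < w.2 + 1, d * d ∣ w.2 → d = 1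

/-- The code of the rational number represented by `((x, y, b), r)`. -/
def ratRepCode (w : RatRep) : ℕ :=
  if w.1.1 < w.1.2.1 then 2 * ((w.1.1 + w.1.2.1) ^ 2 * (w.1.2.2 ^ 2 / w.2)) - 1
  else 2 * ((w.1.1 + w.1.2.1) ^ 2 * (w.1.2.2 ^ 2 / w.2))

/-- A squarefree `r` with `r ∣ b` and `b ∣ r ^ b` has the same prime factors as `b`, hence is its
radical; the closed form for `rhoAbs` then applies. -/
theorem ratRepCode_eq_rho {w : RatRep} (hw : RatRepValid w) :
    ratRepCode w = rho (fracVal w.1) := by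
  obtain ⟨⟨x, y, b⟩, r⟩ := w
  obtain ⟨hxy, hb, hcop, hrb, hbr, hsq⟩ := hw
  simp only at hxy hb hcop hrb hbr hsq
  have hr : 0 < r := Nat.pos_of_dvd_of_pos hrb hb
  have habs : ((x : ℤ) - y).natAbs = x + y := by omega
  have hcop' : ((x : ℤ) - y).natAbs.Coprime b := by
    rw [habs, Nat.coprime_comm]
    exact hcop _ (Nat.lt_succ_of_le (Nat.gcd_le_left _ hb))
      ⟨Nat.gcd_dvd_left _ _, Nat.gcd_dvd_right _ _⟩
  have hval : fracVal (x, y, b) = (((x : ℤ) - y : ℤ) : ℚ) / ((b : ℤ) : ℚ) := by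
    simp [fracVal]
  have hnum : (fracVal (x, y, b)).num = (x : ℤ) - y := by
    rw [hval]
    exact Rat.num_div_eq_of_coprime (by exact_mod_cast hb) (by simpa using hcop')
  have hden : (fracVal (x, y, b)).den = b := by
    have := Rat.den_div_eq_of_coprime (a := (x : ℤ) - y) (b := b) (by exact_mod_cast hb)
      (by simpa using hcop')
    rw [← hval] at this
    exact_mod_cast this
  have hsqf : Squarefree r := by
    intro d hd
    rw [Nat.isUnit_iff]
    refine hsq d (Nat.lt_succ_of_le ?_) hd
    exact Nat.le_of_dvd hr (dvd_of_mul_left_dvd hd)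
  have hpf : b.primeFactors = r.primeFactors := by
    refine Finset.Subset.antisymm (fun p hp => ?_) (Nat.primeFactors_mono hrb hb.ne')
    have hp' := Nat.prime_of_mem_primeFactors hp
    exact Nat.mem_primeFactors.2
      ⟨hp', hp'.dvd_of_dvd_pow ((Nat.dvd_of_mem_primeFactors hp).trans hbr), hr.ne'⟩
  have hrad : ∏ p ∈ b.primeFactors, p = r := by
    rw [hpf, Nat.prod_primeFactors_of_squarefree hsqf]
  rw [rho_eq_zeta, hnum]
  unfold ratRepCode
  simp only
  -- Zero is separate: there `rhoAbs` is an empty product, and the code `0` comes from the sign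
  -- alone.
  by_cases h0 : (x : ℤ) - y = 0
  · have hx : x = 0 := by omega
    have hy : y = 0 := by omega
    simp [hx, hy, zeta]
  have hne : fracVal (x, y, b) ≠ 0 := fun h => h0 (by rw [← hnum, h]; rfl)
  have hM : rhoAbs (fracVal (x, y, b)) = (x + y) ^ 2 * (b ^ 2 / r) := by
    have h := rhoAbs_mul_prod_primeFactors hne
    rw [hden, hrad, hnum, habs] at h
    rw [← Nat.mul_div_assoc _ (hrb.trans (dvd_pow_self b two_ne_zero)), ← h,
      Nat.mul_div_cancel _ hr]
  have hpos := rhoAbs_pos (fracVal (x, y, b))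
  rw [← hM]
  split
  · rw [Int.sign_eq_neg_one_of_neg (by omega), neg_one_mul, zeta_neg_natCast hpos]
  · rw [Int.sign_eq_one_of_pos (by omega), one_mul, zeta_natCast]

theorem exists_ratRep (q : ℚ) : ∃ w : RatRep, RatRepValid w ∧ fracVal w.1 = q := by
  -- Positive and negative parts of the numerator, at least one of which is zero, and the radical of
  -- the denominator.
  refine ⟨((q.num.toNat, (-q.num).toNat, q.den), ∏ p ∈ q.den.primeFactors, p), ⟨by simp only; omega,
    q.den_pos, ?_, Nat.prod_primeFactors_dvd _, ?_, ?_⟩, ?_⟩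
  · rintro d - ⟨h1, h2⟩
    have : q.num.toNat + (-q.num).toNat = q.num.natAbs := by omega
    simp only at h1 h2
    rw [this] at h2
    exact Nat.eq_one_of_dvd_coprimes q.reduced h2 h1
  · simp only
    conv_lhs => rw [← Nat.prod_factorization_pow_eq_self q.den_ne_zero, Finsupp.prod]
    rw [← Finset.prod_pow]
    refine Finset.prod_dvd_prod_of_dvd _ _ fun p hp => pow_dvd_pow _ ?_
    -- Every exponent in `b` is below `b`, so `b` divides the `b`-th power of its radical.
    exact (Nat.factorization_lt p q.den_ne_zero).le
  · rintro d - h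
    have hs : Squarefree (∏ p ∈ q.den.primeFactors, p) := by
      refine Finset.squarefree_prod_of_pairwise_isCoprime (fun p hp p' hp' hne => ?_)
        fun p hp => (Nat.prime_of_mem_primeFactors hp).prime.squarefree
      exact Nat.coprime_iff_isRelPrime.1 ((Nat.coprime_primes (Nat.prime_of_mem_primeFactors hp)
        (Nat.prime_of_mem_primeFactors hp')).2 hne)
    exact Nat.isUnit_iff.1 (hs d h)
  · unfold fracVal
    have h : ((q.num.toNat : ℚ) - ((-q.num).toNat : ℚ)) = q.num := by
      have : (q.num.toNat : ℤ) - ((-q.num).toNat : ℤ) = q.num := by omega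
      exact_mod_cast this
    simp only [h]
    exact Rat.num_div_den q

/-! ### Closure properties of primitive recursive and computable functions. -/

section Computability

variable {α β σ : Type} [Primcodable α] [Primcodable β] [Primcodable σ]

theorem primrecPred_imp {p q : α → Prop} (hp : PrimrecPred p) (hq : PrimrecPred q) :
    PrimrecPred fun a => p a → q a :=
  (hp.not.or hq).of_eq fun _ => imp_iff_not_or.symm

theorem primrecPred_forall_lt {f : α → ℕ} {p : α → ℕ → Prop} (hf : Primrec f)
    (hp : PrimrecRel p) : PrimrecPred fun a => ∀ x < f a, p a x :=
  ((PrimrecRel.forall_mem_list (R := fun x a => p a x) hp.swap).comp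
    (Primrec.list_range.comp hf) Primrec.id).of_eq fun a => by simp

theorem primrecPred_forall_fin : ∀ {n : ℕ} {p : Fin n → α → Prop},
    (∀ i, PrimrecPred (p i)) → PrimrecPred fun a => ∀ i, p i a
  | 0, _, _ => ((Primrec.eq (α := ℕ)).comp (Primrec.const 0) (Primrec.const 0)).of_eq fun _ => by
      simp
  | _ + 1, _, h => ((h 0).and (primrecPred_forall_fin fun i => h i.succ)).of_eq fun _ => by
      rw [Fin.forall_fin_succ]

theorem primrec_apply {n : ℕ} {f : α → Fin n → β} (hf : Primrec f) (i : Fin n) :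
    Primrec fun a => f a i :=
  Primrec.fin_app.comp hf (Primrec.const i)

theorem primrec_nat_pow : Primrec₂ ((· ^ ·) : ℕ → ℕ → ℕ) :=
  (Primrec.nat_rec' (f := fun p : ℕ × ℕ => p.2) (g := fun _ => 1)
    (h := fun p q => q.2 * p.1) Primrec.snd (Primrec.const 1)
    (Primrec.nat_mul.comp (Primrec.snd.comp Primrec.snd)
      (Primrec.fst.comp Primrec.fst))).of_eq fun p => by
    obtain ⟨x, n⟩ := p
    induction n with
    | zero => rfl
    | succ n ih => simpa [pow_succ] using congrArg (· * x) ih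

theorem primrecRel_nat_dvd : PrimrecRel ((· ∣ ·) : ℕ → ℕ → Prop) :=
  (Primrec.eq.comp (Primrec.nat_mod.comp Primrec.snd Primrec.fst)
    (Primrec.const 0)).of_eq fun _ => (Nat.dvd_iff_mod_eq_zero).symm

/-- Unbounded search for a witness. -/
theorem exists_partrec_dom_iff {p : α → β → Prop} (hp : PrimrecRel p) :
    ∃ f : α →. ℕ, Partrec f ∧ ∀ a, (f a).Dom ↔ ∃ b, p a b := by
  classical
  refine ⟨fun a => Nat.rfindOpt fun n =>
    (Encodable.decode (α := β) n).bind fun b => if p a b then some n else none, ?_, fun a => ?_⟩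
  · refine Partrec.rfindOpt (Primrec.to_comp ?_)
    refine Primrec.option_bind (Primrec.decode.comp Primrec.snd) ?_
    refine Primrec.ite ?_ (Primrec.option_some.comp (Primrec.snd.comp Primrec.fst))
      (Primrec.const none)
    exact PrimrecRel.comp hp (Primrec.fst.comp Primrec.fst) Primrec.snd
  · rw [Nat.rfindOpt_dom]
    constructor
    · rintro ⟨n, x, h⟩
      obtain ⟨b, -, hb⟩ := Option.bind_eq_some_iff.1 h
      exact ⟨b, by by_contra hn; simp [hn] at hb⟩
    · rintro ⟨b, hb⟩
      exact ⟨Encodable.encode b, Encodable.encode b, by simp [hb]⟩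

/-- The parameter theorem. -/
theorem exists_computable_code {f : α × ℕ →. ℕ} (hf : Partrec f) :
    ∃ r : α → Nat.Partrec.Code, Computable r ∧ ∀ a s, (r a).eval s = f (a, s) := by
  obtain ⟨c, hc⟩ := Nat.Partrec.Code.exists_code.1 hf
  refine ⟨fun a => c.curry (Encodable.encode a),
    Computable.comp (f := fun n => c.curry n)
      (Nat.Partrec.Code.primrec₂_curry.comp (Primrec.const c) Primrec.id).to_comp
      Computable.encode, fun a s => ?_⟩
  have h := congrFun hc (Encodable.encode (a, s))
  simp only [Encodable.encodek, Part.coe_some, Part.bind_some] at h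
  rw [Nat.Partrec.Code.eval_curry]
  refine Eq.trans h ?_
  simp [Part.map_id']

/-- The inverse of a computable bijection onto `ℕ` is computable. -/
theorem computable_of_rightInverse {f : α → ℕ} (hf : Primrec f) (hinj : Function.Injective f)
    {g : ℕ → α} (hg : Function.RightInverse g f) : Computable g := by
  classical
  have : Partrec fun s => (Nat.rfindOpt fun n =>
      (Encodable.decode (α := α) n).bind fun a => if f a = s then some a else none) := by
    refine Partrec.rfindOpt (Primrec.to_comp ?_)
    refine Primrec.option_bind (Primrec.decode.comp Primrec.snd) ?_
    refine Primrec.ite ?_ (Primrec.option_some.comp Primrec.snd) (Primrec.const none)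
    exact Primrec.eq.comp (hf.comp Primrec.snd) (Primrec.fst.comp Primrec.fst)
  refine this.of_eq_tot fun s => ?_
  have hdom : (Nat.rfindOpt fun n => (Encodable.decode (α := α) n).bind
      fun a => if f a = s then some a else none).Dom :=
    Nat.rfindOpt_dom.2 ⟨Encodable.encode (g s), g s, by simp [hg s]⟩
  obtain ⟨a, ha⟩ := Part.dom_iff_mem.1 hdom
  obtain ⟨n, hn⟩ := Nat.rfindOpt_spec ha
  obtain ⟨b, -, hb⟩ := Option.bind_eq_some_iff.1 hn
  by_cases h : f b = s
  · rw [if_pos h, Option.some_inj] at hb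
    rwa [show g s = a from hinj ((hg s).trans (hb ▸ h.symm))]
  · simp [h] at hb

end Computability

/-! ### Computability of the codings -/

/-- The successor of a code is the next point on the same antidiagonal, or the first point of the
next antidiagonal when `y = 0`. -/
theorem cantorPair_surjective (s : ℕ) : ∃ x y, cantorPair x y = s := by
  induction s with
  | zero => exact ⟨0, 0, rfl⟩
  | succ s ih =>
    obtain ⟨x, y, h⟩ := ih
    have h1 := two_mul_cantorPair x y
    cases y with
    | zero =>
      refine ⟨0, x + 1, ?_⟩
      have h2 := two_mul_cantorPair 0 (x + 1)
      nlinarith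
    | succ y =>
      refine ⟨x + 1, y, ?_⟩
      have h2 := two_mul_cantorPair (x + 1) y
      nlinarith

theorem seqCode_surjective : ∀ n : ℕ, Function.Surjective (seqCode (n := n + 1))
  | 0, s => ⟨fun _ => s, rfl⟩
  | n + 1, s => by
      obtain ⟨x, y, h⟩ := cantorPair_surjective s
      obtain ⟨z, hz⟩ := seqCode_surjective n x
      refine ⟨Fin.snoc (α := fun _ => ℕ) z y, ?_⟩
      simp [seqCode, hz, h]

theorem seqCode_seqProj {n : ℕ} (hn : 0 < n) (s : ℕ) :
    seqCode (fun i : Fin n => seqProj i s) = s := by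
  obtain ⟨n, rfl⟩ := Nat.exists_eq_add_of_lt hn
  rw [zero_add] at *
  exact Function.rightInverse_invFun (seqCode_surjective n) s

theorem primrec_cantorPair : Primrec₂ cantorPair := by
  refine (Primrec.nat_div.comp (Primrec.nat_add.comp (Primrec.nat_mul.comp
    (Primrec.nat_add.comp Primrec.fst Primrec.snd)
    (Primrec.succ.comp (Primrec.nat_add.comp Primrec.fst Primrec.snd)))
    (Primrec.nat_mul.comp (Primrec.const 2) Primrec.fst)) (Primrec.const 2)).of_eq fun p => ?_
  have := two_mul_cantorPair p.1 p.2
  simp only [Nat.succ_eq_add_one]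
  omega

theorem primrec_seqCode {α : Type} [Primcodable α] : ∀ {n : ℕ} {f : Fin n → α → ℕ},
    (∀ i, Primrec (f i)) → Primrec fun a => seqCode fun i => f i a
  | 0, _, _ => Primrec.const 0
  | 1, _, h => h 0
  | n + 2, f, h =>
      primrec_cantorPair.comp (primrec_seqCode (f := fun i : Fin (n + 1) => f i.castSucc)
        fun i => h i.castSucc) (h (Fin.last _))

/-- `seqProj` is defined by a choice of inverse; since `seqCode` is bijective for `n ≥ 1`, that
inverse can be found by search. -/
theorem computable_seqProj {n : ℕ} (hn : 0 < n) (i : Fin n) :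
    Computable (seqProj i) := by
  have h : Computable fun s => fun i : Fin n => seqProj i s :=
    computable_of_rightInverse (f := seqCode)
      (primrec_seqCode (f := fun i (x : Fin n → ℕ) => x i) fun i => primrec_apply Primrec.id i)
      (seqCode_injective n) (seqCode_seqProj hn)
  exact Computable.fin_app.comp h (Computable.const i)

theorem primrecRel_fracLE : PrimrecRel FracLE := by
  have n1 : Primrec fun p : Frac × Frac => p.1.1 := Primrec.fst.comp Primrec.fst
  have n2 : Primrec fun p : Frac × Frac => p.2.1 := Primrec.fst.comp Primrec.snd
  have s1 : Primrec fun p : Frac × Frac => p.1.2 := Primrec.snd.comp Primrec.fst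
  have s2 : Primrec fun p : Frac × Frac => p.2.2 := Primrec.snd.comp Primrec.snd
  exact Primrec.nat_le.comp
    (Primrec.nat_add.comp (Primrec.nat_mul.comp n1 (Primrec.snd.comp s2))
      (Primrec.nat_mul.comp (Primrec.fst.comp s2) (Primrec.snd.comp s1)))
    (Primrec.nat_add.comp (Primrec.nat_mul.comp n2 (Primrec.snd.comp s1))
      (Primrec.nat_mul.comp (Primrec.fst.comp s1) (Primrec.snd.comp s2)))

theorem primrecPred_ratRepValid : PrimrecPred RatRepValid := by
  have x : Primrec fun w : RatRep => w.1.1 := Primrec.fst.comp Primrec.fst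
  have t : Primrec fun w : RatRep => w.1.2 := Primrec.snd.comp Primrec.fst
  have y : Primrec fun w : RatRep => w.1.2.1 := Primrec.fst.comp t
  have b : Primrec fun w : RatRep => w.1.2.2 := Primrec.snd.comp t
  have r : Primrec fun w : RatRep => w.2 := Primrec.snd
  refine PrimrecPred.and (PrimrecPred.or (Primrec.eq.comp x (Primrec.const 0))
    (Primrec.eq.comp y (Primrec.const 0))) (PrimrecPred.and
      (Primrec.nat_lt.comp (Primrec.const 0) b) (PrimrecPred.and ?_ (PrimrecPred.and
        (primrecRel_nat_dvd.comp r b) (PrimrecPred.and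
          (primrecRel_nat_dvd.comp b (primrec_nat_pow.comp r b)) ?_))))
  · refine primrecPred_forall_lt (Primrec.succ.comp b) (primrecPred_imp (PrimrecPred.and ?_ ?_) ?_)
    · exact primrecRel_nat_dvd.comp Primrec.snd (b.comp Primrec.fst)
    · exact primrecRel_nat_dvd.comp Primrec.snd
        ((Primrec.nat_add.comp x y).comp Primrec.fst)
    · exact Primrec.eq.comp Primrec.snd (Primrec.const 1)
  · refine primrecPred_forall_lt (Primrec.succ.comp r) (primrecPred_imp ?_ ?_)
    · exact primrecRel_nat_dvd.comp (Primrec.nat_mul.comp Primrec.snd Primrec.snd)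
        (r.comp Primrec.fst)
    · exact Primrec.eq.comp Primrec.snd (Primrec.const 1)

theorem primrec_ratRepCode : Primrec ratRepCode := by
  have x : Primrec fun w : RatRep => w.1.1 := Primrec.fst.comp Primrec.fst
  have t : Primrec fun w : RatRep => w.1.2 := Primrec.snd.comp Primrec.fst
  have y : Primrec fun w : RatRep => w.1.2.1 := Primrec.fst.comp t
  have b : Primrec fun w : RatRep => w.1.2.2 := Primrec.snd.comp t
  have r : Primrec fun w : RatRep => w.2 := Primrec.snd
  have h : Primrec fun w : RatRep =>
      2 * ((w.1.1 + w.1.2.1) ^ 2 * (w.1.2.2 ^ 2 / w.2)) :=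
    Primrec.nat_mul.comp (Primrec.const 2) (Primrec.nat_mul.comp
      (primrec_nat_pow.comp (Primrec.nat_add.comp x y) (Primrec.const 2))
      (Primrec.nat_div.comp (primrec_nat_pow.comp b (Primrec.const 2)) r))
  exact Primrec.ite (Primrec.nat_lt.comp x y) (Primrec.nat_sub.comp h (Primrec.const 1)) h

/-! ### Representations of rational intervals -/

/-- A pair of representations of rational numbers. -/
abbrev IntervalRep : Type := RatRep × RatRep

/-- The pair represents the end points of a nonempty interval. -/
def IntervalRepValid (I : IntervalRep) : Prop :=
  RatRepValid I.1 ∧ RatRepValid I.2 ∧ ¬ FracLE I.2.1 I.1.1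

/-- The code of the represented interval. -/
def intervalRepCode (I : IntervalRep) : ℕ := cantorPair (ratRepCode I.1) (ratRepCode I.2)

/-- The represented interval. -/
def intervalRepSet (I : IntervalRep) : Set ℝ := Set.Ioo (fracVal I.1.1 : ℝ) (fracVal I.2.1)

/-- Inclusion of nonempty intervals, in terms of their end points. -/
def IntervalRepLE (I J : IntervalRep) : Prop := FracLE J.1.1 I.1.1 ∧ FracLE I.2.1 J.2.1

theorem intervalRep_lt {I : IntervalRep} (hI : IntervalRepValid I) :
    fracVal I.1.1 < fracVal I.2.1 := by
  have h := hI.2.2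
  rwa [fracLE_iff hI.2.1.2.1 hI.1.2.1, not_le] at h

theorem intervalRepCode_eq {I : IntervalRep} (hI : IntervalRepValid I) :
    intervalRepCode I = ratPair (fracVal I.1.1) (fracVal I.2.1) := by
  rw [intervalRepCode, ratRepCode_eq_rho hI.1, ratRepCode_eq_rho hI.2.1, ratPair]

theorem iota_intervalRepCode {I : IntervalRep} (hI : IntervalRepValid I) :
    iota (intervalRepCode I) = intervalRepSet I := by
  rw [intervalRepCode_eq hI, iota_ratPair, intervalRepSet]

/-- Validity of `I` makes its interval nonempty; an empty one would be included whatever its end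
points. -/
theorem intervalRepLE_iff {I J : IntervalRep} (hI : IntervalRepValid I)
    (hJ : IntervalRepValid J) :
    IntervalRepLE I J ↔ intervalRepSet I ⊆ intervalRepSet J := by
  have h : (fracVal I.1.1 : ℝ) < fracVal I.2.1 := by exact_mod_cast intervalRep_lt hI
  rw [IntervalRepLE, fracLE_iff hJ.1.2.1 hI.1.2.1, fracLE_iff hI.2.1.2.1 hJ.2.1.2.1,
    intervalRepSet, intervalRepSet, Set.Ioo_subset_Ioo_iff h, Rat.cast_le, Rat.cast_le]

theorem exists_intervalRep {a b : ℚ} (h : a < b) :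
    ∃ I : IntervalRep, IntervalRepValid I ∧ fracVal I.1.1 = a ∧ fracVal I.2.1 = b := by
  obtain ⟨v, hv, rfl⟩ := exists_ratRep a
  obtain ⟨w, hw, rfl⟩ := exists_ratRep b
  refine ⟨(v, w), ⟨hv, hw, ?_⟩, rfl, rfl⟩
  rwa [fracLE_iff hw.2.1 hv.2.1, not_le]

/-- A code whose interval is nonempty is the code of a represented interval. -/
theorem exists_intervalRep_of_nonempty {s : ℕ} (h : (iota s).Nonempty) :
    ∃ I : IntervalRep, IntervalRepValid I ∧ intervalRepCode I = s := by
  obtain ⟨x, a, b, rfl, h1, h2⟩ := h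
  obtain ⟨I, hI, rfl, rfl⟩ := exists_intervalRep (a := a) (b := b)
    (by exact_mod_cast h1.trans h2)
  exact ⟨I, hI, intervalRepCode_eq hI⟩

theorem primrecPred_intervalRepValid : PrimrecPred IntervalRepValid :=
  (primrecPred_ratRepValid.comp Primrec.fst).and
    ((primrecPred_ratRepValid.comp Primrec.snd).and
      (primrecRel_fracLE.comp (Primrec.fst.comp Primrec.snd)
        (Primrec.fst.comp Primrec.fst)).not)

theorem primrec_intervalRepCode : Primrec intervalRepCode :=
  primrec_cantorPair.comp (primrec_ratRepCode.comp Primrec.fst)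
    (primrec_ratRepCode.comp Primrec.snd)

theorem primrecRel_intervalRepLE : PrimrecRel IntervalRepLE :=
  PrimrecPred.and
    (primrecRel_fracLE.comp (Primrec.fst.comp (Primrec.fst.comp Primrec.snd))
      (Primrec.fst.comp (Primrec.fst.comp Primrec.fst)))
    (primrecRel_fracLE.comp (Primrec.fst.comp (Primrec.snd.comp Primrec.fst))
      (Primrec.fst.comp (Primrec.snd.comp Primrec.snd)))

/-! ### Finite descriptions of oracles -/

/-- A finite list of intervals and an interval to be repeated after the end of the list. -/
abbrev OracleData : Type := List IntervalRep × IntervalRep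

/-- The `n`-th interval of the described sequence. -/
def oracleInterval (D : OracleData) (n : ℕ) : IntervalRep := D.1[n]?.getD D.2

/-- The described oracles. -/
def dataOracle {k : ℕ} (D : Fin k → OracleData) (i : Fin k) (n : ℕ) : ℕ :=
  intervalRepCode (oracleInterval (D i) n)

/-- The described sequence consists of nonempty intervals and is nested. -/
def OracleDataValid (D : OracleData) : Prop :=
  ∀ n < D.1.length + 1, IntervalRepValid (oracleInterval D n) ∧
    IntervalRepLE (oracleInterval D (n + 1)) (oracleInterval D n)

theorem oracleInterval_of_length_le {D : OracleData} {n : ℕ} (h : D.1.length ≤ n) :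
    oracleInterval D n = D.2 := by
  simp [oracleInterval, List.getElem?_eq_none h]

/-- The sequence is constant from index `D.1.length` on, so the bounded check, which includes that
index, covers all indices. -/
theorem oracleDataValid_iff {D : OracleData} :
    OracleDataValid D ↔ ∀ n, IntervalRepValid (oracleInterval D n) ∧
      IntervalRepLE (oracleInterval D (n + 1)) (oracleInterval D n) := by
  refine ⟨fun h n => ?_, fun h n _ => h n⟩
  rcases lt_or_ge n (D.1.length + 1) with hn | hn
  · exact h n hn
  · have := h D.1.length (Nat.lt_succ_self _)
    rw [oracleInterval_of_length_le le_rfl, oracleInterval_of_length_le (Nat.le_succ _)] at this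
    rwa [oracleInterval_of_length_le (by omega), oracleInterval_of_length_le (by omega)]

theorem primrec_oracleInterval : Primrec₂ oracleInterval :=
  Primrec.option_getD.comp
    (Primrec.list_getElem?.comp (Primrec.fst.comp Primrec.fst) Primrec.snd)
    (Primrec.snd.comp Primrec.fst)

theorem primrecPred_oracleDataValid : PrimrecPred OracleDataValid :=
  primrecPred_forall_lt (Primrec.succ.comp (Primrec.list_length.comp Primrec.fst))
    (PrimrecPred.and
      (primrecPred_intervalRepValid.comp primrec_oracleInterval)
      (primrecRel_intervalRepLE.comp
        (primrec_oracleInterval.comp Primrec.fst (Primrec.succ.comp Primrec.snd))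
        primrec_oracleInterval))

theorem primrec_dataOracle {α : Type} [Primcodable α] {k : ℕ} {D : α → Fin k → OracleData}
    {i : α → Fin k} {n : α → ℕ} (hD : Primrec D) (hi : Primrec i) (hn : Primrec n) :
    Primrec fun a => dataOracle (D a) (i a) (n a) :=
  primrec_intervalRepCode.comp (primrec_oracleInterval.comp (Primrec.fin_app.comp hD hi) hn)

/-! ### Simulation of register machines -/

/-- The configuration with a given instruction number and a given list of register contents,
followed by zeros. -/
def listConfig (c : ℕ × List ℕ) : Config := ⟨c.1, fun r => c.2.getD r 0⟩

/-- Store a value in a register. -/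
def setReg (L : List ℕ) (r v : ℕ) : List ℕ :=
  (List.range (max L.length (r + 1))).map fun i => if i = r then v else L.getD i 0

theorem getD_setReg (L : List ℕ) (r v i : ℕ) :
    (setReg L r v).getD i 0 = Function.update (fun j => L.getD j 0) r v i := by
  unfold setReg
  rw [Function.update_apply, List.getD_eq_getElem?_getD, List.getElem?_map]
  rcases lt_or_ge i (max L.length (r + 1)) with h | h
  · simp [List.getElem?_range h]
  · have h1 : L.length ≤ i := (le_max_left _ _).trans h
    have h2 : i ≠ r := by have := (le_max_right L.length (r + 1)).trans h; omega
    simp [List.getElem?_eq_none, h, h1, h2]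

theorem listConfig_setReg (q : ℕ) (L : List ℕ) (r v : ℕ) :
    listConfig (q, setReg L r v) = ⟨q, Function.update (fun j => L.getD j 0) r v⟩ := by
  unfold listConfig
  congr 1
  exact funext fun i => getD_setReg L r v i

theorem primrec_setReg {α : Type} [Primcodable α] {L : α → List ℕ} {r v : α → ℕ}
    (hL : Primrec L) (hr : Primrec r) (hv : Primrec v) :
    Primrec fun a => setReg (L a) (r a) (v a) := by
  refine Primrec.list_map (Primrec.list_range.comp (Primrec.nat_max.comp
    (Primrec.list_length.comp hL) (Primrec.succ.comp hr))) ?_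
  exact Primrec.ite (Primrec.eq.comp Primrec.snd (hr.comp Primrec.fst)) (hv.comp Primrec.fst)
    ((Primrec.list_getD 0).comp (hL.comp Primrec.fst) Primrec.snd)

/-- The effect of one instruction on a list of register contents. -/
def listRun {k : ℕ} (φ : Fin k → ℕ → ℕ) (c : ℕ × List ℕ) : Instr k → ℕ × List ℕ
  | .zero r => (c.1 + 1, setReg c.2 r 0)
  | .succ r => (c.1 + 1, setReg c.2 r (c.2.getD r 0 + 1))
  | .copy r s => (c.1 + 1, setReg c.2 s (c.2.getD r 0))
  | .jump r s q => (if c.2.getD r 0 = c.2.getD s 0 then q else c.1 + 1, c.2)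
  | .query i r => (c.1 + 1, setReg c.2 r (φ i (c.2.getD r 0)))

theorem listConfig_listRun {k : ℕ} (φ : Fin k → ℕ → ℕ) (c : ℕ × List ℕ) (I : Instr k) :
    listConfig (listRun φ c I) = I.run φ (listConfig c) := by
  cases I <;> simp only [listRun, listConfig_setReg, Instr.run] <;> rfl

/-- One step of a program, on a list of register contents. -/
def listStep {k : ℕ} (P : OracleProgram k) (φ : Fin k → ℕ → ℕ) (c : ℕ × List ℕ) :
    Option (ℕ × List ℕ) :=
  P[c.1]?.map (listRun φ c)

theorem step_listConfig {k : ℕ} (P : OracleProgram k) (φ : Fin k → ℕ → ℕ) (c : ℕ × List ℕ) :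
    P.step φ (listConfig c) = (listStep P φ c).map listConfig := by
  simp only [OracleProgram.step, listStep, Option.map_map, listConfig]
  congr 1
  exact funext fun I => (listConfig_listRun φ c I).symm

/-- A step count turns reachability into a search over a primitive recursive iteration. -/
theorem reaches_iff_exists_iterate {σ : Type} {f : σ → Option σ} {a b : σ} :
    StateTransition.Reaches f a b ↔ ∃ n, (fun o : Option σ => o.bind f)^[n] (some a) = some b := by
  constructor
  · intro h
    induction h with
    | refl => exact ⟨0, rfl⟩
    | tail _ h ih =>
      obtain ⟨n, hn⟩ := ih
      refine ⟨n + 1, ?_⟩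
      rw [Function.iterate_succ_apply', hn]
      exact h
  · rintro ⟨n, hn⟩
    induction n generalizing b with
    | zero =>
      cases hn
      exact Relation.ReflTransGen.refl
    | succ n ih =>
      rw [Function.iterate_succ_apply'] at hn
      obtain ⟨c, hc, hcb⟩ := Option.bind_eq_some_iff.1 hn
      exact (ih hc).tail hcb

/-- The result of running a program for `n` steps on input `l`, if it has halted then. -/
def evalSteps {k : ℕ} (P : OracleProgram k) (φ : Fin k → ℕ → ℕ) (l n : ℕ) : Option ℕ :=
  ((fun o : Option (ℕ × List ℕ) => o.bind (listStep P φ))^[n] (some (0, [l]))).bind fun c =>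
    if P.length ≤ c.1 then some (c.2.getD 0 0) else none

/-- Only finitely many registers are ever nonzero, so lists simulate configurations step by step. A
run has halted exactly when the instruction number is at least the length of the program. -/
theorem mem_eval_iff_exists_evalSteps {k : ℕ} {P : OracleProgram k} {φ : Fin k → ℕ → ℕ}
    {l v : ℕ} : v ∈ P.eval φ l ↔ ∃ n, evalSteps P φ l n = some v := by
  have h0 : (⟨0, Function.update (fun _ => 0) 0 l⟩ : Config) = listConfig (0, [l]) := by
    unfold listConfig
    congr 1
    ext r
    cases r <;> simp
  have htr : StateTransition.eval (P.step φ) (listConfig (0, [l])) =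
      listConfig <$> StateTransition.eval (listStep P φ) (0, [l]) := by
    refine StateTransition.tr_eval' _ _ _ ?_ _
    rw [StateTransition.fun_respects]
    intro c
    have hc := step_listConfig P φ c
    cases h : listStep P φ c with
    | none => simpa [StateTransition.FRespects, h] using hc
    | some c' =>
      rw [h] at hc
      exact Relation.TransGen.single hc
  rw [OracleProgram.eval, h0, htr]
  simp only [Part.map_eq_map, Part.map_map, Part.mem_map_iff, StateTransition.mem_eval,
    reaches_iff_exists_iterate, evalSteps, Option.bind_eq_some_iff]
  have hnone : ∀ c : ℕ × List ℕ, listStep P φ c = none ↔ P.length ≤ c.1 := fun c => by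
    simp [listStep]
  constructor
  · rintro ⟨c, ⟨⟨n, hn⟩, hc⟩, rfl⟩
    exact ⟨n, c, hn, by rw [if_pos ((hnone c).1 hc)]; rfl⟩
  · rintro ⟨n, c, hn, hc⟩
    split at hc
    · next h => exact ⟨c, ⟨⟨n, hn⟩, (hnone c).2 h⟩, Option.some_inj.1 hc⟩
    · cases hc

/-- Case distinction with a parameter; applied repeatedly along `Instr.equivSum`, it assembles the
effect of an instruction from its five kinds. -/
theorem primrec_of_sum {α β γ σ : Type} [Primcodable α] [Primcodable β] [Primcodable γ]
    [Primcodable σ] {f : α × β → σ} {g : α × γ → σ} {h : α × (β ⊕ γ) → σ} (hf : Primrec f)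
    (hg : Primrec g) (hl : ∀ a b, h (a, .inl b) = f (a, b))
    (hr : ∀ a c, h (a, .inr c) = g (a, c)) : Primrec h := by
  refine (Primrec.sumCasesOn (f := fun p : α × (β ⊕ γ) => p.2) (g := fun p b => f (p.1, b))
    (h := fun p c => g (p.1, c)) Primrec.snd
    (hf.comp ((Primrec.fst.comp Primrec.fst).pair Primrec.snd))
    (hg.comp ((Primrec.fst.comp Primrec.fst).pair Primrec.snd))).of_eq ?_
  rintro ⟨a, b | c⟩
  · exact (hl a b).symm
  · exact (hr a c).symm

theorem primrec_listRun {α : Type} [Primcodable α] {k : ℕ} {D : α → Fin k → OracleData}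
    {c : α → ℕ × List ℕ} {I : α → Instr k} (hD : Primrec D) (hc : Primrec c) (hI : Primrec I) :
    Primrec fun a => listRun (dataOracle (D a)) (c a) (I a) := by
  have pc : Primrec fun a => (c a).1 + 1 := Primrec.succ.comp (Primrec.fst.comp hc)
  have reg : Primrec fun a => (c a).2 := Primrec.snd.comp hc
  have get {β : Type} [Primcodable β] {f : α × β → ℕ} (hf : Primrec f) :
      Primrec fun p : α × β => (c p.1).2.getD (f p) 0 :=
    (Primrec.list_getD 0).comp (reg.comp Primrec.fst) hf
  have mk {β : Type} [Primcodable β] {r v : α × β → ℕ} (hr : Primrec r) (hv : Primrec v) :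
      Primrec fun p : α × β => ((c p.1).1 + 1, setReg (c p.1).2 (r p) (v p)) :=
    (pc.comp Primrec.fst).pair (primrec_setReg (reg.comp Primrec.fst) hr hv)
  have h5 : Primrec fun p : α × (Fin k × ℕ) =>
      listRun (dataOracle (D p.1)) (c p.1) (.query p.2.1 p.2.2) :=
    mk (Primrec.snd.comp Primrec.snd) (primrec_dataOracle (hD.comp Primrec.fst)
      (Primrec.fst.comp Primrec.snd) (get (Primrec.snd.comp Primrec.snd)))
  have h4 : Primrec fun p : α × (ℕ × ℕ × ℕ) =>
      listRun (dataOracle (D p.1)) (c p.1) (.jump p.2.1 p.2.2.1 p.2.2.2) :=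
    (Primrec.ite (Primrec.eq.comp (get (Primrec.fst.comp Primrec.snd))
      (get (Primrec.fst.comp (Primrec.snd.comp Primrec.snd))))
      (Primrec.snd.comp (Primrec.snd.comp Primrec.snd)) (pc.comp Primrec.fst)).pair
      (reg.comp Primrec.fst)
  have h3 : Primrec fun p : α × (ℕ × ℕ) =>
      listRun (dataOracle (D p.1)) (c p.1) (.copy p.2.1 p.2.2) :=
    mk (Primrec.snd.comp Primrec.snd) (get (Primrec.fst.comp Primrec.snd))
  have h2 : Primrec fun p : α × ℕ => listRun (dataOracle (D p.1)) (c p.1) (.succ p.2) :=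
    mk Primrec.snd (Primrec.succ.comp (get Primrec.snd))
  have h1 : Primrec fun p : α × ℕ => listRun (dataOracle (D p.1)) (c p.1) (.zero p.2) :=
    mk Primrec.snd (Primrec.const 0)
  have h45 := primrec_of_sum (h := fun p => listRun (dataOracle (D p.1)) (c p.1)
    ((Instr.equivSum k).symm (.inr (.inr (.inr p.2))))) h4 h5 (fun _ _ => rfl) fun _ _ => rfl
  have h345 := primrec_of_sum (h := fun p => listRun (dataOracle (D p.1)) (c p.1)
    ((Instr.equivSum k).symm (.inr (.inr p.2)))) h3 h45 (fun _ _ => rfl) fun _ _ => rfl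
  have h2345 := primrec_of_sum (h := fun p => listRun (dataOracle (D p.1)) (c p.1)
    ((Instr.equivSum k).symm (.inr p.2))) h2 h345 (fun _ _ => rfl) fun _ _ => rfl
  have h12345 := primrec_of_sum (h := fun p => listRun (dataOracle (D p.1)) (c p.1)
    ((Instr.equivSum k).symm p.2)) h1 h2345 (fun _ _ => rfl) fun _ _ => rfl
  have sum : Primrec fun a => Instr.equivSum k (I a) := Primrec.of_equiv.comp hI
  exact (h12345.comp (Primrec.id.pair sum)).of_eq fun a => by simp

theorem primrec_evalSteps {α : Type} [Primcodable α] {k : ℕ} {P : α → OracleProgram k}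
    {D : α → Fin k → OracleData} {l n : α → ℕ} (hP : Primrec P) (hD : Primrec D)
    (hl : Primrec l) (hn : Primrec n) :
    Primrec fun a => evalSteps (P a) (dataOracle (D a)) (l a) (n a) := by
  refine Primrec.option_bind (Primrec.nat_iterate hn (Primrec.option_some.comp
    ((Primrec.const 0).pair (Primrec.list_cons.comp hl (Primrec.const [])))) ?_) ?_
  · refine Primrec.option_bind Primrec.snd ?_
    refine Primrec.option_map (Primrec.list_getElem?.comp
      (hP.comp (Primrec.fst.comp Primrec.fst)) (Primrec.fst.comp Primrec.snd)) ?_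
    exact primrec_listRun (hD.comp (Primrec.fst.comp (Primrec.fst.comp Primrec.fst)))
      (Primrec.snd.comp Primrec.fst) Primrec.snd
  · refine Primrec.ite (Primrec.nat_le.comp (Primrec.list_length.comp (hP.comp Primrec.fst))
      (Primrec.fst.comp Primrec.snd)) (Primrec.option_some.comp ((Primrec.list_getD 0).comp
        (Primrec.snd.comp Primrec.snd) (Primrec.const 0))) (Primrec.const none)

/-- A halting computation uses only finitely many values of its oracles. -/
theorem exists_forall_mem_eval {k : ℕ} {P : OracleProgram k} {φ : Fin k → ℕ → ℕ} {l v : ℕ}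
    (h : v ∈ P.eval φ l) :
    ∃ N, ∀ φ' : Fin k → ℕ → ℕ, (∀ i, ∀ n < N, φ' i n = φ i n) → v ∈ P.eval φ' l := by
  obtain ⟨C, hC, rfl⟩ := (Part.mem_map_iff _).1 h
  obtain ⟨hr, hs⟩ := StateTransition.mem_eval.1 hC
  suffices ∃ N, ∀ φ' : Fin k → ℕ → ℕ, (∀ i, ∀ n < N, φ' i n = φ i n) →
      StateTransition.Reaches (P.step φ') ⟨0, Function.update (fun _ => 0) 0 l⟩ C by
    obtain ⟨N, hN⟩ := this
    refine ⟨N, fun φ' hφ' => Part.mem_map _ (StateTransition.mem_eval.2 ⟨hN φ' hφ', ?_⟩)⟩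
    simpa [OracleProgram.step] using hs
  clear h hC hs
  induction hr with
  | refl => exact ⟨0, fun _ _ => Relation.ReflTransGen.refl⟩
  | @tail A B _ hAB ih =>
    obtain ⟨N, hN⟩ := ih
    obtain ⟨I, hI, rfl⟩ := Option.map_eq_some_iff.1 hAB
    -- Only a query looks at an oracle, and at a single argument.
    obtain ⟨N', hN'⟩ : ∃ N', ∀ φ' : Fin k → ℕ → ℕ, (∀ i, ∀ n < N', φ' i n = φ i n) →
        I.run φ' A = I.run φ A := by
      cases I with
      | query i r =>
        refine ⟨A.reg r + 1, fun φ' h => ?_⟩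
        simp only [Instr.run, h i _ (Nat.lt_succ_self _)]
      | _ => exact ⟨0, fun _ _ => rfl⟩
    refine ⟨max N N', fun φ' h => ?_⟩
    refine (hN φ' fun i n hn => h i n (hn.trans_le (le_max_left _ _))).tail ?_
    refine Option.map_eq_some_iff.2 ⟨I, hI, ?_⟩
    exact hN' φ' fun i n hn => h i n (hn.trans_le (le_max_right _ _))

open Filter Topology

/-! ### Nested oracles -/

/-- A finite nested sequence of rational intervals around `x` extends to a nested oracle. -/
theorem exists_isNestedOracle_extension {x : ℝ} {f : ℕ → ℕ} {N : ℕ}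
    (hx : ∀ n ≤ N, x ∈ iota (f n)) (hf : ∀ n < N, iota (f (n + 1)) ⊆ iota (f n)) :
    ∃ φ, rationalIntervals.IsNestedOracle φ x ∧ ∀ n ≤ N, φ n = f n := by
  have hdom : ∀ n ≤ N, f n ∈ rationalIntervals.dom := by
    intro n hn
    obtain ⟨a, b, hab, h1, h2⟩ := hx n hn
    refine ⟨a, b, by exact_mod_cast h1.trans h2, ?_⟩
    rw [hab]
    exact iota_ratPair a b
  obtain ⟨a, b, hab, ha, hb⟩ := hx N le_rfl
  obtain ⟨u, hu, hux, hut⟩ := Real.exists_seq_rat_strictMono_tendsto x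
  obtain ⟨v, hv, hvx, hvt⟩ := Real.exists_seq_rat_strictAnti_tendsto x
  -- Beyond `N`, intervals shrinking to `x` are cut down to the last given interval `(a, b)`, which
  -- keeps the sequence nested.
  set φ : ℕ → ℕ := fun n => if n ≤ N then f n else ratPair (max a (u n)) (min b (v n)) with hφ
  have hle : ∀ n ≤ N, φ n = f n := fun n hn => if_pos hn
  have hgt : ∀ n, N < n → φ n = ratPair (max a (u n)) (min b (v n)) := fun n hn =>
    if_neg hn.not_ge
  have hlt : ∀ n, (max a (u n) : ℚ) < min b (v n) := by
    intro n
    have h1 := hux n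
    have h2 := hvx n
    refine max_lt (lt_min ?_ ?_) (lt_min ?_ ?_) <;> rw [← Rat.cast_lt (K := ℝ)] <;> linarith
  have hmem : ∀ n, x ∈ iota (φ n) := by
    intro n
    rcases le_or_gt n N with hn | hn
    · rw [hle n hn]
      exact hx n hn
    · rw [hgt n hn, iota_ratPair, Rat.cast_max, Rat.cast_min]
      exact ⟨max_lt ha (hux n), lt_min hb (hvx n)⟩
  refine ⟨φ, ⟨⟨fun n => ?_, ?_, ?_, ?_⟩, fun n => ?_⟩, hle⟩
  · rcases le_or_gt n N with hn | hn
    · rw [hle n hn]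
      exact hdom n hn
    · refine ⟨_, _, hlt n, ?_⟩
      rw [hgt n hn]
      exact iota_ratPair _ _
  · rintro _ ⟨_, ⟨n, rfl⟩, rfl⟩
    rcases le_or_gt n N with hn | hn
    · rw [hle n hn]
      exact hdom n hn
    · refine ⟨_, _, hlt n, ?_⟩
      rw [hgt n hn]
      exact iota_ratPair _ _
  · rintro _ ⟨_, ⟨n, rfl⟩, rfl⟩
    exact hmem n
  · rintro _ ⟨p, q, -, rfl⟩ ⟨hp, hq⟩
    obtain ⟨n, h1, h2, h3⟩ := ((hut.eventually (lt_mem_nhds hp)).and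
      ((hvt.eventually (gt_mem_nhds hq)).and (eventually_gt_atTop N))).exists
    refine ⟨_, ⟨_, ⟨n, rfl⟩, rfl⟩, ?_⟩
    rw [hgt n h3]
    change iota _ ⊆ _
    rw [iota_ratPair, Rat.cast_max, Rat.cast_min]
    exact Set.Ioo_subset_Ioo (h1.le.trans (le_max_right _ _)) ((min_le_right _ _).trans h2.le)
  · change iota _ ⊆ iota _
    rcases lt_trichotomy n N with hn | rfl | hn
    · rw [hle n hn.le, hle (n + 1) hn]
      exact hf n hn
    · rw [hle n le_rfl, hgt (n + 1) (Nat.lt_succ_self n), hab, iota_ratPair, iota_ratPair,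
        Rat.cast_max, Rat.cast_min]
      exact Set.Ioo_subset_Ioo (le_max_left _ _) (min_le_left _ _)
    · rw [hgt n hn, hgt (n + 1) (hn.trans (Nat.lt_succ_self n)), iota_ratPair, iota_ratPair]
      refine Set.Ioo_subset_Ioo ?_ ?_
      · exact_mod_cast max_le_max_left a (hu (Nat.lt_succ_self n)).le
      · exact_mod_cast min_le_min_left b (hv (Nat.lt_succ_self n)).le

theorem exists_isNestedOracle (x : ℝ) : ∃ φ, rationalIntervals.IsNestedOracle φ x := by
  obtain ⟨a, ha⟩ := exists_rat_lt x
  obtain ⟨b, hb⟩ := exists_rat_gt x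
  obtain ⟨φ, hφ, -⟩ := exists_isNestedOracle_extension (x := x) (f := fun _ => ratPair a b)
    (N := 0) (fun _ _ => by rw [iota_ratPair]; exact ⟨ha, hb⟩) fun _ h => absurd h (Nat.not_lt_zero _)
  exact ⟨φ, hφ⟩

theorem mem_iota_of_isNestedOracle {φ : ℕ → ℕ} {x : ℝ}
    (h : rationalIntervals.IsNestedOracle φ x) (n : ℕ) : x ∈ iota (φ n) :=
  h.1.2.2.1 _ ⟨_, ⟨n, rfl⟩, rfl⟩

theorem iota_antitone_of_isNestedOracle {φ : ℕ → ℕ} {x : ℝ}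
    (h : rationalIntervals.IsNestedOracle φ x) : Antitone fun n => iota (φ n) :=
  antitone_nat_of_succ_le h.2

theorem exists_iota_subset_of_isNestedOracle {φ : ℕ → ℕ} {x : ℝ}
    (h : rationalIntervals.IsNestedOracle φ x) {a b : ℚ} (hx : x ∈ Set.Ioo (a : ℝ) b) :
    ∃ n, iota (φ n) ⊆ Set.Ioo (a : ℝ) b := by
  obtain ⟨_, ⟨_, ⟨n, rfl⟩, rfl⟩, hn⟩ :=
    h.1.2.2.2 _ ⟨a, b, by exact_mod_cast hx.1.trans hx.2, rfl⟩ hx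
  exact ⟨n, hn⟩

theorem isOpen_iota (s : ℕ) : IsOpen (iota s) := by
  by_cases h : (iota s).Nonempty
  · obtain ⟨x, a, b, rfl, -⟩ := h
    rw [iota_ratPair]
    exact isOpen_Ioo
  · rw [Set.not_nonempty_iff_eq_empty.1 h]
    exact isOpen_empty

/-- A function that satisfies Kreisel's criterion is continuous. -/
theorem continuous_of_oracle_functionals {k m : ℕ} {P : Fin m → OracleProgram k}
    {ψ : (Fin k → ℝ) → (Fin m → ℝ)}
    (hψ : ∀ (x : Fin k → ℝ) (φ : Fin k → ℕ → ℕ),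
      (∀ i, rationalIntervals.IsNestedOracle (φ i) (x i)) →
      ∀ j, ∃ κ : ℕ → ℕ, (∀ l, (P j).eval φ l = Part.some (κ l)) ∧
        rationalIntervals.IsNestedOracle κ (ψ x j)) : Continuous ψ := by
  refine continuous_pi fun j => continuous_iff_continuousAt.2 fun x => ?_
  choose φ hφ using fun i => exists_isNestedOracle (x i)
  obtain ⟨κ, hκ, hκo⟩ := hψ x φ hφ j
  rw [ContinuousAt, Real.isTopologicalBasis_Ioo_rat.nhds_hasBasis.tendsto_right_iff]
  rintro V ⟨hV, hxV⟩
  simp only [Set.mem_iUnion, Set.mem_singleton_iff] at hV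
  obtain ⟨a, b, -, rfl⟩ := hV
  -- Some output interval already lies in the target. It depends on the oracle values below `N`
  -- only, and these begin a nested oracle for every `x'` in the box of the `N`-th intervals.
  obtain ⟨l, hl⟩ := exists_iota_subset_of_isNestedOracle hκo hxV
  obtain ⟨N, hN⟩ := exists_forall_mem_eval (Part.eq_some_iff.1 (hκ l))
  have hev : ∀ᶠ x' in 𝓝 x, ∀ i, x' i ∈ iota (φ i N) :=
    eventually_all.2 fun i => (continuous_apply i).continuousAt.eventually_mem
      ((isOpen_iota _).mem_nhds (mem_iota_of_isNestedOracle (hφ i) N))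
  filter_upwards [hev] with x' hx'
  choose φ' hφ' hφφ' using fun i => exists_isNestedOracle_extension (f := φ i) (N := N)
    (fun n hn => iota_antitone_of_isNestedOracle (hφ i) hn (hx' i)) fun n _ => (hφ i).2 n
  obtain ⟨κ', hκ', hκo'⟩ := hψ x' φ' hφ' j
  have h1 := hN φ' fun i n hn => hφφ' i n hn.le
  rw [hκ' l, Part.mem_some_iff] at h1
  exact hl (h1 ▸ mem_iota_of_isNestedOracle hκo' l)

/-- The graph of a continuous function into a Hausdorff space is closed. -/
theorem PhysicalModel.KreiselPrograms.isClosed_states {k m : ℕ}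
    {M : PhysicalModel (Fin (k + m) → ℝ) ℝ} {P : Fin m → OracleProgram k}
    (h : M.KreiselPrograms P) : IsClosed M.states := by
  obtain ⟨ψ, ⟨-, hS⟩, hψ⟩ := h
  rw [hS]
  have := continuous_of_oracle_functionals hψ
  exact isClosed_eq (this.comp (by fun_prop)) (by fun_prop)

/-! ### The decimal intervals -/

theorem decimalIntervals_coding_surjective (c : ℚ) {U : Set ℝ}
    (hU : U ∈ (decimalIntervals c).basis) : ∃ s, iota s = U := by
  obtain ⟨m, n, -, rfl⟩ := hU
  refine ⟨ratPair ((m : ℚ) / 10 ^ n - c / 10 ^ n) (((m : ℚ) + 1) / 10 ^ n + c / 10 ^ n), ?_⟩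
  rw [iota_ratPair]
  push_cast
  rfl

theorem isTopologicalBasis_decimalIntervals {c : ℚ} (hc : 0 < c) :
    TopologicalSpace.IsTopologicalBasis (decimalIntervals c).basis := by
  have hc' : (0 : ℝ) < c := by exact_mod_cast hc
  refine TopologicalSpace.isTopologicalBasis_of_isOpen_of_nhds ?_ fun x U hx hU => ?_
  · rintro _ ⟨m, n, -, rfl⟩
    exact isOpen_Ioo
  obtain ⟨ε, hε, hεU⟩ := Metric.isOpen_iff.1 hU x hx
  -- With `m = ⌊x * 10 ^ (n + 1)⌋`, both end points lie within `(1 + c) / 10 ^ (n + 1)` of `x`.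
  -- Since `c > 0`, `x` is interior even when it equals `m / 10 ^ (n + 1)`.
  obtain ⟨n, hn⟩ := exists_nat_gt ((1 + c) / ε)
  have hpow : (n : ℝ) < 10 ^ (n + 1) := by
    exact_mod_cast (Nat.lt_pow_self (by norm_num : 1 < 10)).trans
      (Nat.pow_lt_pow_right (by norm_num) (Nat.lt_succ_self n))
  have hD : (0 : ℝ) < 10 ^ (n + 1) := by positivity
  have hlen : 1 + (c : ℝ) < ε * 10 ^ (n + 1) := by
    have := (div_lt_iff₀ hε).1 (hn.trans hpow)
    linarith
  have h1 := Int.floor_le (x * 10 ^ (n + 1))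
  have h2 := Int.lt_floor_add_one (x * 10 ^ (n + 1))
  refine ⟨_, ⟨⌊x * 10 ^ (n + 1)⌋, n + 1, Nat.succ_pos n, rfl⟩, ?_, ?_⟩
  · rw [← sub_div, ← add_div]
    constructor
    · rw [div_lt_iff₀ hD]
      linarith
    · rw [lt_div_iff₀ hD]
      linarith
  · refine Set.Subset.trans ?_ hεU
    rw [Real.ball_eq_Ioo, ← sub_div, ← add_div]
    refine Set.Ioo_subset_Ioo ?_ ?_
    · rw [le_div_iff₀ hD]
      linarith
    · rw [div_le_iff₀ hD]
      linarith

theorem isEffectiveTopology_decimalIntervals {c : ℚ} (hc : 0 < c) :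
    (decimalIntervals c).IsEffectiveTopology :=
  ⟨⟨inferInstance, isTopologicalBasis_decimalIntervals hc, inferInstance⟩,
    fun _ hU => decimalIntervals_coding_surjective c hU⟩

/-- The codes of the boxes of decimal intervals that meet a set `A`. -/
def meetingBoxes {n : ℕ} (c : ℚ) (A : Set (Fin n → ℝ)) : Set ℕ :=
  {s | (∀ i : Fin n, seqProj i s ∈ (decimalIntervals c).dom) ∧
    ∃ z ∈ A, ∀ i, z i ∈ iota (seqProj i s)}

/-- The boxes that meet a closed set form a basic representation of it. -/
theorem isBasicRepresentation_meetingBoxes {n : ℕ} {c : ℚ} (hc : 0 < c)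
    {A : Set (Fin n → ℝ)} (hA : IsClosed A) :
    (CodedBasis.product fun _ : Fin n => decimalIntervals c).IsBasicRepresentation
      (meetingBoxes c A) A := by
  refine ⟨fun s hs => ⟨_, hs.1, rfl⟩, fun x => ⟨fun hx => ?_, ?_⟩⟩
  · refine ⟨{U | U ∈ (CodedBasis.product fun _ : Fin n => decimalIntervals c).basis ∧ x ∈ U},
      ⟨fun U hU => hU.1, fun U hU => hU.2, fun V hV hxV => ⟨V, ⟨hV, hxV⟩, subset_rfl⟩⟩, ?_⟩
    rintro _ ⟨⟨V, hV, rfl⟩, hxV⟩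
    choose a ha using fun i => decimalIntervals_coding_surjective c (hV i)
    refine ⟨seqCode a, ⟨fun i => ?_, x, hx, fun i => ?_⟩, ?_⟩
    · change iota (seqProj i (seqCode a)) ∈ (decimalIntervals c).basis
      rw [seqProj_seqCode, ha]
      exact hV i
    · rw [seqProj_seqCode, ha]
      exact hxV i trivial
    · change (Set.univ.pi fun i => iota (seqProj i (seqCode a))) = _
      simp only [seqProj_seqCode, ha]
  · rintro ⟨L, ⟨-, -, hL⟩, hLR⟩
    -- Each neighbourhood of `x` contains a member of `L`, hence a box that meets `A`.
    refine hA.closure_subset (mem_closure_iff_nhds.2 fun W hW => ?_)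
    rw [nhds_pi, Filter.mem_pi'] at hW
    obtain ⟨I, t, ht, htW⟩ := hW
    choose V hV hxV hVt using fun i =>
      (isTopologicalBasis_decimalIntervals hc).mem_nhds_iff.1 (ht i)
    obtain ⟨U, hU, hUV⟩ := hL (Set.univ.pi V) ⟨V, hV, rfl⟩ fun i _ => hxV i
    obtain ⟨s, ⟨-, z, hz, hzs⟩, rfl⟩ := hLR hU
    exact ⟨z, htW fun i _ => hVt i (hUV (fun i _ => hzs i) i trivial), hz⟩

/-! ### Enumeration of the boxes that meet the graph -/

/-- The numbers `m₁, m₂, d` witness that the represented interval has the end points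
`(m₁ - m₂ - c) / 10ᵈ⁺¹` and `(m₁ - m₂ + 1 + c) / 10ᵈ⁺¹`. -/
def IsDecimal (c : ℚ) (I : IntervalRep) (e : ℕ × ℕ × ℕ) : Prop :=
  let D := c.den * 10 ^ (e.2.2 + 1)
  let lo : Frac := (e.1 * c.den, e.2.1 * c.den + c.num.toNat, D)
  let hi : Frac := ((e.1 + 1) * c.den + c.num.toNat, e.2.1 * c.den, D)
  (FracLE I.1.1 lo ∧ FracLE lo I.1.1) ∧ FracLE I.2.1 hi ∧ FracLE hi I.2.1

theorem isDecimal_iff {c : ℚ} (hc : 0 < c) {I : IntervalRep} (hI : IntervalRepValid I)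
    (e : ℕ × ℕ × ℕ) : IsDecimal c I e ↔
      fracVal I.1.1 = ((e.1 : ℚ) - e.2.1 - c) / 10 ^ (e.2.2 + 1) ∧
      fracVal I.2.1 = ((e.1 : ℚ) - e.2.1 + 1 + c) / 10 ^ (e.2.2 + 1) := by
  have hD : 0 < c.den * 10 ^ (e.2.2 + 1) := Nat.mul_pos c.den_pos (by positivity)
  have hcn : (c.num.toNat : ℚ) = c * c.den := by
    rw [Rat.mul_den_eq_num, ← Int.cast_natCast, Int.toNat_of_nonneg (Rat.num_pos.2 hc).le]
  have hcd : (c.den : ℚ) ≠ 0 := by exact_mod_cast c.den_ne_zero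
  have h10 : (10 : ℚ) ^ (e.2.2 + 1) ≠ 0 := by positivity
  have hlo : fracVal (e.1 * c.den, e.2.1 * c.den + c.num.toNat, c.den * 10 ^ (e.2.2 + 1)) =
      ((e.1 : ℚ) - e.2.1 - c) / 10 ^ (e.2.2 + 1) := by
    simp only [fracVal]
    push_cast
    rw [hcn]
    field_simp
    ring
  have hhi : fracVal ((e.1 + 1) * c.den + c.num.toNat, e.2.1 * c.den,
      c.den * 10 ^ (e.2.2 + 1)) = ((e.1 : ℚ) - e.2.1 + 1 + c) / 10 ^ (e.2.2 + 1) := by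
    simp only [fracVal]
    push_cast
    rw [hcn]
    field_simp
    ring
  simp only [IsDecimal]
  rw [fracLE_iff hI.1.2.1 hD, fracLE_iff hD hI.1.2.1, fracLE_iff hI.2.1.2.1 hD,
    fracLE_iff hD hI.2.1.2.1, ← le_antisymm_iff, ← le_antisymm_iff, hlo, hhi]

/-- A nonempty open interval determines its end points, so membership in the family becomes an
equation between fractions, with `m` split into a difference of natural numbers and the positive
exponent written as `d + 1`. -/
theorem intervalRepCode_mem_dom_iff {c : ℚ} (hc : 0 < c) {I : IntervalRep}
    (hI : IntervalRepValid I) :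
    intervalRepCode I ∈ (decimalIntervals c).dom ↔ ∃ e, IsDecimal c I e := by
  have hlt : (fracVal I.1.1 : ℝ) < fracVal I.2.1 := by exact_mod_cast intervalRep_lt hI
  change iota (intervalRepCode I) ∈ (decimalIntervals c).basis ↔ _
  rw [iota_intervalRepCode hI]
  simp only [isDecimal_iff hc hI]
  constructor
  · rintro ⟨m, n, hn, h⟩
    obtain ⟨d, rfl⟩ := Nat.exists_eq_succ_of_ne_zero hn.ne'
    have hne : (intervalRepSet I).Nonempty := Set.nonempty_Ioo.2 hlt
    rw [h] at hne
    obtain ⟨h1, h2⟩ := (Set.Ioo_subset_Ioo_iff hlt).1 h.subset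
    obtain ⟨h3, h4⟩ := (Set.Ioo_subset_Ioo_iff (Set.nonempty_Ioo.1 hne)).1 h.superset
    replace h1 := h3.antisymm h1
    replace h2 := h2.antisymm h4
    refine ⟨(m.toNat, (-m).toNat, d), ?_⟩
    have hm : ((m.toNat : ℚ) - ((-m).toNat : ℚ)) = m := by
      have : (m.toNat : ℤ) - ((-m).toNat : ℤ) = m := by omega
      exact_mod_cast this
    simp only [hm]
    rw [← sub_div] at h1
    rw [← add_div] at h2
    constructor
    · exact_mod_cast h1
    · exact_mod_cast h2
  · rintro ⟨⟨m₁, m₂, d⟩, h1, h2⟩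
    refine ⟨(m₁ : ℤ) - m₂, d + 1, Nat.succ_pos d, ?_⟩
    rw [intervalRepSet, h1, h2, ← sub_div, ← add_div]
    push_cast
    rfl

/-- A box of decimal intervals, finite oracle data, and for every functional an argument, a
number of steps and an output interval. -/
abbrev BoxWitness (k m : ℕ) : Type :=
  (Fin (k + m) → IntervalRep × ℕ × ℕ × ℕ) × (Fin k → OracleData) × (Fin m → ℕ × ℕ × IntervalRep)

/-- The witness shows that the box with a given code contains a point of the graph of the function
computed by given programs. -/
def IsBoxWitness {k m : ℕ} (c : ℚ) (a : (Fin m → OracleProgram k) × ℕ) (w : BoxWitness k m) :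
    Prop :=
  a.2 = seqCode (fun i => intervalRepCode (w.1 i).1) ∧
  (∀ i, IntervalRepValid (w.1 i).1 ∧ IsDecimal c (w.1 i).1 (w.1 i).2) ∧
  (∀ i, OracleDataValid (w.2.1 i) ∧ IntervalRepLE (w.2.1 i).2 (w.1 (Fin.castAdd m i)).1) ∧
  ∀ j, evalSteps (a.1 j) (dataOracle w.2.1) (w.2.2 j).1 (w.2.2 j).2.1 =
      some (intervalRepCode (w.2.2 j).2.2) ∧
    IntervalRepValid (w.2.2 j).2.2 ∧ IntervalRepLE (w.2.2 j).2.2 (w.1 (Fin.natAdd k j)).1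

theorem primrecRel_isDecimal (c : ℚ) : PrimrecRel (IsDecimal c) := by
  have lo : Primrec fun p : IntervalRep × ℕ × ℕ × ℕ => p.1.1.1 :=
    Primrec.fst.comp (Primrec.fst.comp Primrec.fst)
  have hi : Primrec fun p : IntervalRep × ℕ × ℕ × ℕ => p.1.2.1 :=
    Primrec.fst.comp (Primrec.snd.comp Primrec.fst)
  have m₁ : Primrec fun p : IntervalRep × ℕ × ℕ × ℕ => p.2.1 := Primrec.fst.comp Primrec.snd
  have m₂ : Primrec fun p : IntervalRep × ℕ × ℕ × ℕ => p.2.2.1 :=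
    Primrec.fst.comp (Primrec.snd.comp Primrec.snd)
  have d : Primrec fun p : IntervalRep × ℕ × ℕ × ℕ => p.2.2.2 :=
    Primrec.snd.comp (Primrec.snd.comp Primrec.snd)
  have D : Primrec fun p : IntervalRep × ℕ × ℕ × ℕ => c.den * 10 ^ (p.2.2.2 + 1) :=
    Primrec.nat_mul.comp (Primrec.const _)
      (primrec_nat_pow.comp (Primrec.const 10) (Primrec.succ.comp d))
  have dlo := (Primrec.nat_mul.comp m₁ (Primrec.const c.den)).pair ((Primrec.nat_add.comp
    (Primrec.nat_mul.comp m₂ (Primrec.const c.den)) (Primrec.const c.num.toNat)).pair D)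
  have dhi := (Primrec.nat_add.comp (Primrec.nat_mul.comp (Primrec.succ.comp m₁)
    (Primrec.const c.den)) (Primrec.const c.num.toNat)).pair
    ((Primrec.nat_mul.comp m₂ (Primrec.const c.den)).pair D)
  exact PrimrecPred.and
    (PrimrecPred.and (primrecRel_fracLE.comp lo dlo) (primrecRel_fracLE.comp dlo lo))
    (PrimrecPred.and (primrecRel_fracLE.comp hi dhi) (primrecRel_fracLE.comp dhi hi))

theorem primrecRel_isBoxWitness {k m : ℕ} (c : ℚ) :
    PrimrecRel (IsBoxWitness (k := k) (m := m) c) := by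
  have P (j) : Primrec fun p : ((Fin m → OracleProgram k) × ℕ) × BoxWitness k m => p.1.1 j :=
    primrec_apply (Primrec.fst.comp Primrec.fst) j
  have w : Primrec fun p : ((Fin m → OracleProgram k) × ℕ) × BoxWitness k m => p.2 := Primrec.snd
  have b (i) : Primrec fun p : ((Fin m → OracleProgram k) × ℕ) × BoxWitness k m => p.2.1 i :=
    primrec_apply (Primrec.fst.comp w) i
  have D : Primrec fun p : ((Fin m → OracleProgram k) × ℕ) × BoxWitness k m => p.2.2.1 :=
    Primrec.fst.comp (Primrec.snd.comp w)
  have r (j) : Primrec fun p : ((Fin m → OracleProgram k) × ℕ) × BoxWitness k m => p.2.2.2 j :=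
    primrec_apply (Primrec.snd.comp (Primrec.snd.comp w)) j
  refine PrimrecPred.and (Primrec.eq.comp (Primrec.snd.comp Primrec.fst) (primrec_seqCode fun i =>
    primrec_intervalRepCode.comp (Primrec.fst.comp (b i)))) (PrimrecPred.and ?_
      (PrimrecPred.and ?_ ?_)) <;> refine primrecPred_forall_fin fun i => ?_
  · exact (primrecPred_intervalRepValid.comp (Primrec.fst.comp (b i))).and
      ((primrecRel_isDecimal c).comp (Primrec.fst.comp (b i)) (Primrec.snd.comp (b i)))
  · exact (primrecPred_oracleDataValid.comp (primrec_apply D i)).and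
      (primrecRel_intervalRepLE.comp (Primrec.snd.comp (primrec_apply D i))
        (Primrec.fst.comp (b _)))
  · have J := Primrec.snd.comp (Primrec.snd.comp (r i))
    exact (Primrec.eq.comp (primrec_evalSteps (P i) D (Primrec.fst.comp (r i))
      (Primrec.fst.comp (Primrec.snd.comp (r i))))
      (Primrec.option_some.comp (primrec_intervalRepCode.comp J))).and
      ((primrecPred_intervalRepValid.comp J).and
        (primrecRel_intervalRepLE.comp J (Primrec.fst.comp (b _))))

theorem intervalRepSet_nonempty {I : IntervalRep} (hI : IntervalRepValid I) :
    (intervalRepSet I).Nonempty :=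
  Set.nonempty_Ioo.2 (by exact_mod_cast intervalRep_lt hI)

variable {k m : ℕ} {M : PhysicalModel (Fin (k + m) → ℝ) ℝ} {P : Fin m → OracleProgram k}

/-- The oracle data are not oracles for any point, as they stop shrinking. But for any `u` in their
last intervals, genuine nested oracles for `u` agree with them on all values that a computation
uses. So the outputs are correct for `u`, and `(u, ψ u)` lies in the box. -/
theorem mem_meetingBoxes_of_isBoxWitness {c : ℚ} (hc : 0 < c) (hP : M.KreiselPrograms P) {s : ℕ}
    {w : BoxWitness k m} (hw : IsBoxWitness c (P, s) w) : s ∈ meetingBoxes c M.states := by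
  obtain ⟨ψ, ⟨-, hS⟩, hψ⟩ := hP
  obtain ⟨hs, hb, hD, hr⟩ := hw
  simp only at hs hr
  have hproj : ∀ i, seqProj i s = intervalRepCode (w.1 i).1 := fun i => by
    rw [hs, seqProj_seqCode]
  have hval : ∀ i n, IntervalRepValid (oracleInterval (w.2.1 i) n) := fun i n =>
    (oracleDataValid_iff.1 (hD i).1 n).1
  have hiota : ∀ i n, iota (dataOracle w.2.1 i n) = intervalRepSet (oracleInterval (w.2.1 i) n) :=
    fun i n => iota_intervalRepCode (hval i n)
  have hnest : ∀ i n, iota (dataOracle w.2.1 i (n + 1)) ⊆ iota (dataOracle w.2.1 i n) := by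
    intro i n
    rw [hiota, hiota]
    exact (intervalRepLE_iff (hval i _) (hval i _)).1 (oracleDataValid_iff.1 (hD i).1 n).2
  have hlast : ∀ i, oracleInterval (w.2.1 i) (w.2.1 i).1.length = (w.2.1 i).2 := fun i =>
    oracleInterval_of_length_le le_rfl
  have hlv : ∀ i, IntervalRepValid (w.2.1 i).2 := fun i => hlast i ▸ hval i _
  choose u hu using fun i => intervalRepSet_nonempty (hlv i)
  have huo : ∀ i n, u i ∈ iota (dataOracle w.2.1 i n) := by
    intro i n
    refine antitone_nat_of_succ_le (f := fun n => iota (dataOracle w.2.1 i n)) (hnest i)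
      (le_max_left n (w.2.1 i).1.length) ?_
    simp only [hiota]
    rw [oracleInterval_of_length_le (le_max_right _ _)]
    exact hu i
  refine ⟨fun i => ?_, Fin.append u (ψ u), ?_, fun i => ?_⟩
  · rw [hproj]
    exact (intervalRepCode_mem_dom_iff hc (hb i).1).2 ⟨_, (hb i).2⟩
  · rw [hS]
    simp
  · rw [hproj, iota_intervalRepCode (hb i).1]
    refine Fin.addCases (fun i => ?_) (fun j => ?_) i
    · rw [Fin.append_left]
      exact (intervalRepLE_iff (hlv i) (hb _).1).1 (hD i).2 (hu i)
    · rw [Fin.append_right]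
      obtain ⟨h1, h2, h3⟩ := hr j
      obtain ⟨N, hN⟩ := exists_forall_mem_eval (mem_eval_iff_exists_evalSteps.2 ⟨_, h1⟩)
      choose φ hφ hφD using fun i => exists_isNestedOracle_extension (f := dataOracle w.2.1 i)
        (N := N) (fun n _ => huo i n) fun n _ => hnest i n
      obtain ⟨κ, hκ, hκo⟩ := hψ u φ hφ j
      have h4 := hN φ fun i n hn => hφD i n hn.le
      rw [hκ, Part.mem_some_iff] at h4
      have h5 := mem_iota_of_isNestedOracle hκo (w.2.2 j).1
      rw [← h4, iota_intervalRepCode h2] at h5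
      exact (intervalRepLE_iff h2 (hb _).1).1 h3 h5

/-- The certificate comes from truncating genuine nested oracles for the first `k` coordinates of a
point of the graph inside the box. -/
theorem exists_isBoxWitness {c : ℚ} (hc : 0 < c) (hm : 0 < m) (hP : M.KreiselPrograms P) {s : ℕ}
    (hs : s ∈ meetingBoxes c M.states) : ∃ w, IsBoxWitness c (P, s) w := by
  obtain ⟨ψ, ⟨-, hS⟩, hψ⟩ := hP
  obtain ⟨hdom, z, hz, hzs⟩ := hs
  rw [hS] at hz
  choose B hB hBs using fun i : Fin (k + m) => exists_intervalRep_of_nonempty ⟨z i, hzs i⟩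
  have hzB : ∀ i, z i ∈ intervalRepSet (B i) := fun i => by
    rw [← iota_intervalRepCode (hB i), hBs]
    exact hzs i
  choose e he using fun i => (intervalRepCode_mem_dom_iff hc (hB i)).1 (hBs i ▸ hdom i)
  choose φ hφ using fun i => exists_isNestedOracle (z (Fin.castAdd m i))
  choose κ hκ hκo using hψ _ φ hφ
  have hzj : ∀ j, ψ (fun i => z (Fin.castAdd m i)) j = z (Fin.natAdd k j) := congrFun hz
  choose l hl using fun j => exists_iota_subset_of_isNestedOracle (hκo j)
    (a := fracVal (B (Fin.natAdd k j)).1.1) (b := fracVal (B (Fin.natAdd k j)).2.1)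
    (hzj j ▸ hzB _)
  choose N hN using fun j => exists_forall_mem_eval (Part.eq_some_iff.1 (hκ j (l j)))
  choose N' hN' using fun i => exists_iota_subset_of_isNestedOracle (hφ i) (hzB (Fin.castAdd m i))
  obtain ⟨K, hK⟩ := Finite.exists_le N
  obtain ⟨K', hK'⟩ := Finite.exists_le N'
  choose E hE hEφ using fun i n => exists_intervalRep_of_nonempty
    ⟨_, mem_iota_of_isNestedOracle (hφ i) n⟩
  choose J hJ hJκ using fun j => exists_intervalRep_of_nonempty
    ⟨_, mem_iota_of_isNestedOracle (hκo j) (l j)⟩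
  -- From index `K'` on the oracle intervals fit into the box, and below `K` lie all oracle values
  -- used by the computations.
  set L := max K K'
  have hEs : ∀ i n, intervalRepSet (E i n) = iota (φ i n) := fun i n => by
    rw [← iota_intervalRepCode (hE i n), hEφ]
  set D : Fin k → OracleData := fun i => ((List.range L).map (E i), E i L) with hDdef
  have hDn : ∀ i n, oracleInterval (D i) n = E i (min n L) := by
    intro i n
    rcases lt_or_ge n L with hn | hn
    · simp [D, oracleInterval, List.getElem?_range hn, hn.le]
    · rw [oracleInterval_of_length_le (by simpa [D] using hn), min_eq_right hn]
  have hev : ∀ j, ∃ n, evalSteps (P j) (dataOracle D) (l j) n = some (κ j (l j)) := fun j =>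
    mem_eval_iff_exists_evalSteps.1 <| hN j _ fun i n hn => by
      rw [dataOracle, hDn, min_eq_left (hn.le.trans ((hK j).trans (le_max_left _ _))), hEφ]
  choose n hn using hev
  refine ⟨(fun i => (B i, e i), D, fun j => (l j, n j, J j)), ?_, fun i => ⟨hB i, he i⟩,
    fun i => ⟨oracleDataValid_iff.2 fun n => ⟨?_, ?_⟩, ?_⟩, fun j => ⟨?_, hJ j, ?_⟩⟩
  · simp only [hBs]
    -- Here `0 < m` enters: every number is the code of a sequence of positive length.
    exact (seqCode_seqProj (by omega) s).symm
  · rw [hDn]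
    exact hE i _
  · rw [hDn, hDn, intervalRepLE_iff (hE i _) (hE i _), hEs, hEs]
    exact iota_antitone_of_isNestedOracle (hφ i) (min_le_min_right L (Nat.le_succ n))
  · rw [intervalRepLE_iff (hE i _) (hB _), hEs]
    exact (iota_antitone_of_isNestedOracle (hφ i) ((hK' i).trans (le_max_right K K'))).trans
      (hN' i)
  · simp only [hJκ]
    exact hn j
  · rw [intervalRepLE_iff (hJ j) (hB _), ← iota_intervalRepCode (hJ j), hJκ]
    exact hl j

/-! ### The computable model -/

/-- The pairs of an input and a number of steps after which a program first halts. -/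
def haltingTimes (r : Nat.Partrec.Code) : Set ℕ :=
  {w | (r.evaln (w.unpair.2 + 1) w.unpair.1).isSome ∧ r.evaln w.unpair.2 w.unpair.1 = none}

/-- Success of `evaln` is monotone in the bound and fails at bound `0`, so there is exactly one `t`
with failure at `t` and success at `t + 1`. -/
theorem existsUnique_haltingTime {r : Nat.Partrec.Code} {s : ℕ} (hs : (r.eval s).Dom) :
    ∃! t, Nat.pair s t ∈ haltingTimes r := by
  classical
  have hmono : ∀ {t t' : ℕ}, t ≤ t' → (r.evaln t s).isSome → (r.evaln t' s).isSome := by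
    intro t t' h ht
    obtain ⟨v, hv⟩ := Option.isSome_iff_exists.1 ht
    exact Option.isSome_iff_exists.2 ⟨v, Nat.Partrec.Code.evaln_mono h hv⟩
  have hex : ∃ t, (r.evaln (t + 1) s).isSome := by
    obtain ⟨v, hv⟩ := Part.dom_iff_mem.1 hs
    obtain ⟨t, ht⟩ := Nat.Partrec.Code.evaln_complete.1 hv
    exact ⟨t, hmono (Nat.le_succ t) (Option.isSome_iff_exists.2 ⟨v, ht⟩)⟩
  refine ⟨Nat.find hex, ?_, fun t ht => ?_⟩
  · simp only [haltingTimes, Set.mem_ofPred_eq, Nat.unpair_pair]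
    refine ⟨Nat.find_spec hex, ?_⟩
    cases h : Nat.find hex with
    | zero => simp [Nat.Partrec.Code.evaln]
    | succ t =>
      have := Nat.find_min hex (m := t) (by omega)
      simpa using this
  · simp only [haltingTimes, Set.mem_ofPred_eq, Nat.unpair_pair] at ht
    refine le_antisymm ?_ (Nat.find_min' hex ht.1)
    by_contra h
    have := hmono (Nat.succ_le_of_lt (not_le.1 h)) (Nat.find_spec hex)
    rw [ht.2] at this
    cases this

theorem dom_of_mem_haltingTimes {r : Nat.Partrec.Code} {w : ℕ} (hw : w ∈ haltingTimes r) :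
    (r.eval w.unpair.1).Dom := by
  obtain ⟨v, hv⟩ := Option.isSome_iff_exists.1 hw.1
  exact Part.dom_iff_mem.2 ⟨v, Nat.Partrec.Code.evaln_sound hv⟩

theorem primrecPred_mem_haltingTimes :
    PrimrecPred fun p : Nat.Partrec.Code × ℕ => p.2 ∈ haltingTimes p.1 := by
  have s : Primrec fun p : Nat.Partrec.Code × ℕ => p.2.unpair.1 :=
    Primrec.fst.comp (Primrec.unpair.comp Primrec.snd)
  have t : Primrec fun p : Nat.Partrec.Code × ℕ => p.2.unpair.2 :=
    Primrec.snd.comp (Primrec.unpair.comp Primrec.snd)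
  refine PrimrecPred.and (Primrec.eq.comp (Primrec.option_isSome.comp
    (Nat.Partrec.Code.primrec_evaln.comp (((Primrec.succ.comp t).pair Primrec.fst).pair s)))
    (Primrec.const true)) (Primrec.eq.comp (Nat.Partrec.Code.primrec_evaln.comp
      ((t.pair Primrec.fst).pair s)) (Primrec.const none))

open Classical in
/-- The characteristic function of the set of halting times. -/
noncomputable def haltingIndicator (p : Nat.Partrec.Code × ℕ) : ℕ :=
  if p.2 ∈ haltingTimes p.1 then 1 else 0

theorem primrec_haltingIndicator : Primrec haltingIndicator := by
  classical
  exact Primrec.ite primrecPred_mem_haltingTimes (Primrec.const 1) (Primrec.const 0)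

/-- The model with the coordinate projections of codes as observable quantities. -/
def codeModel (n : ℕ) (R : Set ℕ) : PhysicalModel ℕ ℕ where
  states := R
  observables := Set.range fun i : Fin n => seqProj i

/-- The model of halting times, with the projections of the inputs as observable quantities. -/
def haltingModel (n : ℕ) (r : Nat.Partrec.Code) : PhysicalModel ℕ ℕ where
  states := haltingTimes r
  observables := Set.range fun (i : Fin n) w => seqProj i w.unpair.1

theorem isComputable_haltingModel {n : ℕ} (hn : 0 < n) (r : Nat.Partrec.Code) :
    (haltingModel n r).IsComputable := by
  refine ⟨?_, ?_⟩
  · exact (primrecPred_mem_haltingTimes.comp ((Primrec.const r).pair Primrec.id)).computablePred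
  · rintro _ ⟨i, rfl⟩
    exact (computable_seqProj hn i).comp (Computable.fst.comp Computable.unpair)

/-- A model whose set of states is the domain of a program is isomorphic to the model of halting
times of that program. -/
theorem exists_iso_haltingModel (n : ℕ) {r : Nat.Partrec.Code} {R : Set ℕ}
    (hr : ∀ s, (r.eval s).Dom ↔ s ∈ R) :
    ∃ e : PhysicalModel.Iso (codeModel n R) (haltingModel n r),
      ∀ a w, (e.onObservables a).1 w = a.1 w.unpair.1 := by
  -- The bijection on states is built backwards, by forgetting the halting time.
  let f : (haltingModel n r).states → (codeModel n R).states := fun w =>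
    ⟨w.1.unpair.1, (hr _).1 (dom_of_mem_haltingTimes w.2)⟩
  have hf : Function.Bijective f := by
    constructor
    · intro w w' h
      have h1 : w.1.unpair.1 = w'.1.unpair.1 := congrArg Subtype.val h
      have hu := existsUnique_haltingTime (dom_of_mem_haltingTimes w.2)
      have h2 : w.1.unpair.2 = w'.1.unpair.2 := by
        refine hu.unique ?_ ?_
        · rw [Nat.pair_unpair]; exact w.2
        · rw [h1, Nat.pair_unpair]; exact w'.2
      refine Subtype.ext ?_
      rw [← Nat.pair_unpair w.1, ← Nat.pair_unpair w'.1, h1, h2]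
    · rintro ⟨s, hs⟩
      obtain ⟨t, ht, -⟩ := existsUnique_haltingTime ((hr s).2 hs)
      exact ⟨⟨Nat.pair s t, ht⟩, Subtype.ext (by simp [f])⟩
  let g : (codeModel n R).observables → (haltingModel n r).observables := fun a =>
    ⟨fun w => a.1 w.unpair.1, by obtain ⟨_, i, rfl⟩ := a; exact ⟨i, rfl⟩⟩
  have hg : Function.Bijective g := by
    constructor
    · intro a b h
      refine Subtype.ext (funext fun s => ?_)
      -- Observables are functions on all of `ℕ`, so they may be compared at numbers that are not
      -- states.
      simpa [g] using congrFun (congrArg Subtype.val h) (Nat.pair s 0)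
    · rintro ⟨_, i, rfl⟩
      exact ⟨⟨_, i, rfl⟩, rfl⟩
  refine ⟨⟨(Equiv.ofBijective f hf).symm, Equiv.ofBijective g hg, fun a s => ?_⟩, fun a w => rfl⟩
  have h := Equiv.ofBijective_apply_symm_apply f hf s
  exact congrArg a.1 (congrArg Subtype.val h).symm

end CPM

/-! ### The main theorem. -/

theorem mainTheorem1 (k m : ℕ) (hm : 0 < m) (c : ℚ) (hc : 0 < c) :
    (∀ M : CPM.PhysicalModel (Fin (k + m) → ℝ) ℝ, M.SatisfiesKreisel →
      ∃ N C : CPM.PhysicalModel ℕ ℕ,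
        CPM.PhysicalModel.IsBasicRepresentation (fun _ => CPM.decimalIntervals c) N M ∧
        C.IsComputable ∧ N.Isomorphic C) ∧
    ∃ (r t : (Fin m → CPM.OracleProgram k) → Nat.Partrec.Code)
      (b : (Fin m → CPM.OracleProgram k) → Fin (k + m) → Nat.Partrec.Code),
      Computable r ∧ Computable t ∧ Computable b ∧
      ∀ (M : CPM.PhysicalModel (Fin (k + m) → ℝ) ℝ) (P : Fin m → CPM.OracleProgram k),
        M.KreiselPrograms P →
        ∃ N C : CPM.PhysicalModel ℕ ℕ,
          CPM.PhysicalModel.IsBasicRepresentation (fun _ => CPM.decimalIntervals c) N M ∧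
          (∀ s, ((r P).eval s).Dom ↔ s ∈ N.states) ∧
          C.IsComputable ∧
          (∀ s, (s ∈ C.states → (t P).eval s = Part.some 1) ∧
            (s ∉ C.states → (t P).eval s = Part.some 0)) ∧
          ∃ e : CPM.PhysicalModel.Iso N C,
            ∀ (i : Fin (k + m)) (a : N.observables), a.1 = CPM.seqProj i →
              ∀ s, (b P i).eval s = Part.some ((e.onObservables a).1 s) := by
  have hn : 0 < k + m := by omega
  -- One search program for certificates, with the oracle programs as a parameter; its sections have
  -- the sets `R` as domains.
  obtain ⟨f, hf, hfd⟩ := CPM.exists_partrec_dom_iff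
    (CPM.primrecRel_isBoxWitness (k := k) (m := m) c)
  obtain ⟨r, hr, hre⟩ := CPM.exists_computable_code hf
  have ht₀ : Computable fun p : (Fin m → CPM.OracleProgram k) × ℕ =>
      CPM.haltingIndicator (r p.1, p.2) :=
    CPM.primrec_haltingIndicator.to_comp.comp ((hr.comp Computable.fst).pair Computable.snd)
  obtain ⟨t, ht, hte⟩ := CPM.exists_computable_code ht₀.partrec
  have hb₀ (i : Fin (k + m)) : Computable fun w : ℕ => CPM.seqProj i w.unpair.1 :=
    (CPM.computable_seqProj hn i).comp (Computable.fst.comp Computable.unpair)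
  choose b hb using fun i => Nat.Partrec.Code.exists_code.1 (Partrec.nat_iff.1 (hb₀ i).partrec)
  have uniform : ∀ (M : CPM.PhysicalModel (Fin (k + m) → ℝ) ℝ) (P : Fin m → CPM.OracleProgram k),
      M.KreiselPrograms P →
      ∃ N C : CPM.PhysicalModel ℕ ℕ,
        CPM.PhysicalModel.IsBasicRepresentation (fun _ => CPM.decimalIntervals c) N M ∧
        (∀ s, ((r P).eval s).Dom ↔ s ∈ N.states) ∧
        C.IsComputable ∧
        (∀ s, (s ∈ C.states → (t P).eval s = Part.some 1) ∧
          (s ∉ C.states → (t P).eval s = Part.some 0)) ∧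
        ∃ e : CPM.PhysicalModel.Iso N C,
          ∀ (i : Fin (k + m)) (a : N.observables), a.1 = CPM.seqProj i →
            ∀ s, (b i).eval s = Part.some ((e.onObservables a).1 s) := by
    intro M P hP
    have hdom : ∀ s, ((r P).eval s).Dom ↔ s ∈ CPM.meetingBoxes c M.states := fun s => by
      rw [hre, hfd]
      exact ⟨fun ⟨_, hw⟩ => CPM.mem_meetingBoxes_of_isBoxWitness hc hP hw,
        CPM.exists_isBoxWitness hc hm hP⟩
    obtain ⟨e, he⟩ := CPM.exists_iso_haltingModel (k + m) hdom
    refine ⟨_, _, ⟨?_, fun _ => CPM.isEffectiveTopology_decimalIntervals hc,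
      CPM.isBasicRepresentation_meetingBoxes hc hP.isClosed_states, rfl⟩, hdom,
      CPM.isComputable_haltingModel hn (r P), fun s => ⟨fun hs => ?_, fun hs => ?_⟩, e,
      fun i a ha s => ?_⟩
    · obtain ⟨ψ, hψ, -⟩ := hP
      exact hψ.1
    · rw [hte]
      exact congrArg Part.some (if_pos hs)
    · rw [hte]
      exact congrArg Part.some (if_neg hs)
    · rw [he, ha, hb]
      rfl
  -- The programs for the observables do not depend on `P`: they read a coordinate of the first
  -- component of a pair.
  refine ⟨fun M ⟨P, hP⟩ => ?_, r, t, fun _ => b, hr, ht, Computable.const b, uniform⟩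
  obtain ⟨N, C, h1, -, h2, -, e, -⟩ := uniform M P hP
  exact ⟨N, C, h1, h2, ⟨e⟩⟩
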